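/- Let $(X,d)$ be a metric space that is proper (closed balls are compact) and discrete (as a topological space). A *combing* of $X$ starting at $p\in X$ is a map $H\colon X\times\mathbb N\to X$, $H_n(x):=H(x,n)$, such that $H_0(x)=p=H_n(p)$ for all $x,n$; for every bounded $K\subset X$ there is $N$ with $H_n(x)=x$ for all $n\ge N$, $x\in K$; and for every $r\geq 0$ there is $s$ such that $d(x,y)\le r$ and $|m-n|\le r$ imply $d(H_m(x),H_n(y))\le s$. It is *coherent* if $\sup\{d(H_m(H_n(x)),H_m(x)) : x\in X,\ m\le n\}<\infty$, and *expanding* if there is $R_{exp}$ such that for all $r>0$ and $n\in\mathbb N$ there is a bounded $K\subset X$ with $d(H_n(y),H_n(x))\le R_{exp}$ whenever $x\in X\setminus K$ and $d(y,x)\le r$. For $R\ge 0$ let $P_R(X)$ be (the geometric realization of) the Rips complex, whose simplices are the finite non-empty sets of points of $X$ with mutual distance at most $R$. It carries the coarse structure in which a set $E$ of pairs is an entourage iff the vertices of the simplices carrying $u$ and $v$ are uniformly close for $(u,v)\in E$. The combing $H$ is transported to a combing of $P_R(X)$, also denoted $H$, through the coarse equivalence $X\subset P_R(X)$: it restricts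 to $H$ on the vertices, and every other combing of $P_R(X)$ that is uniformly close to $H$ on the vertices defines the same compactification. For a space $Y$ with a coarse structure and a combing $H$, the *combing compactification* $\overline{Y}^H$ is the maximal ideal space of the $C^*$-algebra $C_H(Y)$ of all bounded continuous $f\colon Y\to\mathbb C$ of vanishing variation (i.e. for every entourage $E$ and $\varepsilon>0$ one has $|f(x)-f(y)|<\varepsilon$ for all $(x,y)\in E$ with $x$ outside some bounded set) with $\|f\circ H_n-f\|_\infty\to0$, and the *combing corona* $\partial_HY$ is the maximal ideal space of $C_H(Y)/C_0(Y)$, where $C_0(Y)$ consists of the continuous functions that vanish at infinity, i.e. that are arbitrarily small outside bounded sets. Let $\overline{\mathcal P(X)}^H:=\bigcup_{n\in\mathbb N}\overline{P_n(X)}^H$ with the final topology, and $\mathcal P(X):=\bigcup_{n\in\mathbb N} P_n(X)$ its subset. Suppose that $H$ is an expanding and coherent combing of $X$. Then: 1. For $0\le R\le S$ the inclusion $P_R(X)\subset P_S(X)$ induces a closed embedding $\overline{P_R(X)}^H\subset\overline{P_S(X)}^H$ of compact Hausdorff spaces; and for every $R>0$ there is $S>R$ such that $\overline{P_R(X)}^H$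 is contractible in $\overline{P_S(X)}^H$, i.e. this embedding is homotopic to a constant map. 2. $\overline{\mathcal P(X)}^H$ is contractible as a $\sigma$-compact space: there is a homotopy $h\colon[0,1]\times\overline{\mathcal P(X)}^H\to\overline{\mathcal P(X)}^H$ from the identity to a constant map such that for every $m$ there is $n$ with $h([0,1]\times\overline{P_m(X)}^H)\subset\overline{P_n(X)}^H$. 3. The canonical map $\partial_HX\to\overline{\mathcal P(X)}^H$ is a closed embedding with image $\overline{\mathcal P(X)}^H\setminus\mathcal P(X)$, and this image is a $Z$-set: it is closed, and there is a homotopy $(h_t)_{t\in[0,1]}$ of $\overline{\mathcal P(X)}^H$ with $h_0=\mathrm{id}$ and $h_t(\overline{\mathcal P(X)}^H)\subset\overline{\mathcal P(X)}^H\setminus\partial_HX$ for all $t>0$. -/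

import Mathlib

open Set Filter Topology BoundedContinuousFunction
open scoped NNReal unitInterval

/-! ### Coarse spaces -/

/-- A (coarsely connected) coarse structure, given by its entourages. Coarse connectedness,
i.e. the last field, is automatic for spaces that carry a combing; it makes finite unions of bounded
sets bounded. -/
class CoarseSpace (Y : Type*) where
  IsEntourage : Set (Y × Y) → Prop
  diag : IsEntourage {q | q.1 = q.2}
  subset : ∀ {E F : Set (Y × Y)}, IsEntourage F → E ⊆ F → IsEntourage E
  union : ∀ {E F : Set (Y × Y)}, IsEntourage E → IsEntourage F → IsEntourage (E ∪ F)
  inv : ∀ {E : Set (Y × Y)}, IsEntourage E → IsEntourage {q | (q.2, q.1) ∈ E}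
  comp : ∀ {E F : Set (Y × Y)}, IsEntourage E → IsEntourage F →
    IsEntourage {q | ∃ z, (q.1, z) ∈ E ∧ (z, q.2) ∈ F}
  connected : ∀ x y : Y, IsEntourage {(x, y)}

namespace CoarseSpace

/-- The coarse structure of a metric space: the entourages are the subsets of
`{(x, y) | dist x y ≤ r}`, `r` a real number. -/
instance ofMetric (X : Type*) [MetricSpace X] : CoarseSpace X where
  IsEntourage E := ∃ r : ℝ, ∀ q ∈ E, dist q.1 q.2 ≤ r
  diag := ⟨0, fun q hq => by rw [Set.mem_ofPred_eq] at hq; rw [hq, dist_self]⟩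
  subset := fun ⟨r, hr⟩ h => ⟨r, fun q hq => hr q (h hq)⟩
  union := fun ⟨r, hr⟩ ⟨s, hs⟩ => ⟨max r s, fun q hq => hq.elim
    (fun h => (hr q h).trans (le_max_left _ _)) fun h => (hs q h).trans (le_max_right _ _)⟩
  inv := fun ⟨r, hr⟩ => ⟨r, fun q hq => by rw [dist_comm]; exact hr _ hq⟩
  comp := fun ⟨r, hr⟩ ⟨s, hs⟩ => ⟨r + s, fun q ⟨z, h1, h2⟩ =>
    (dist_triangle _ z _).trans (add_le_add (hr _ h1) (hs _ h2))⟩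
  connected x y := ⟨dist x y, fun q hq => by rw [mem_singleton_iff] at hq; rw [hq]⟩

variable {Y : Type*} [CoarseSpace Y]

/-- A subset `B` is bounded if `B × B` is an entourage. -/
def IsBounded (B : Set Y) : Prop := IsEntourage (B ×ˢ B)

theorem isBounded_union {K L : Set Y} (hK : IsBounded K) (hL : IsBounded L) :
    IsBounded (K ∪ L) := by
  rcases K.eq_empty_or_nonempty with rfl | ⟨a, ha⟩
  · rwa [empty_union]
  rcases L.eq_empty_or_nonempty with rfl | ⟨b, hb⟩
  · rwa [union_empty]
  have h1 : IsEntourage {q : Y × Y | ∃ z, (q.1, z) ∈ {q : Y × Y |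
      ∃ w, (q.1, w) ∈ K ×ˢ K ∧ (w, q.2) ∈ ({(a, b)} : Set (Y × Y))} ∧ (z, q.2) ∈ L ×ˢ L} :=
    comp (comp hK (connected a b)) hL
  refine subset (union (union hK hL) (union h1 (inv h1))) ?_
  rintro ⟨x, y⟩ ⟨hx | hx, hy | hy⟩
  · exact Or.inl (Or.inl ⟨hx, hy⟩)
  · exact Or.inr (Or.inl ⟨b, ⟨a, ⟨hx, ha⟩, rfl⟩, hb, hy⟩)
  · exact Or.inr (Or.inr ⟨b, ⟨a, ⟨hy, ha⟩, rfl⟩, hb, hx⟩)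
  · exact Or.inl (Or.inr ⟨hx, hy⟩)

/-- `f` vanishes at infinity. -/
def VanishesAtInfinity (f : Y → ℂ) : Prop :=
  ∀ ε > 0, ∃ K : Set Y, IsBounded K ∧ ∀ x ∉ K, ‖f x‖ < ε

/-- `f` has vanishing variation: for every entourage `E` the `E`-variation
`x ↦ sup {|f x - f y| : (x, y) ∈ E}` vanishes at infinity. -/
def VanishingVariation (f : Y → ℂ) : Prop :=
  ∀ E : Set (Y × Y), IsEntourage E → ∀ ε > 0, ∃ K : Set Y, IsBounded K ∧
    ∀ x y, (x, y) ∈ E → x ∉ K → ‖f x - f y‖ < ε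

/-! ### Combings -/

/-- `H`, with `H n x` the point at time `n` on the path to `x`, is a combing starting at `p`. The
last field says that `(x, n) ↦ H n x` is a controlled map for the product coarse structure on
`Y × ℕ`. -/
structure IsCombing (p : Y) (H : ℕ → Y → Y) : Prop where
  zero : ∀ x, H 0 x = p
  base : ∀ n, H n p = p
  eventually_id : ∀ K : Set Y, IsBounded K → ∃ N : ℕ, ∀ n ≥ N, ∀ x ∈ K, H n x = x
  controlled : ∀ E : Set (Y × Y), IsEntourage E → ∀ k : ℕ,
    IsEntourage {q : Y × Y | ∃ x y m n, (x, y) ∈ E ∧ m ≤ n + k ∧ n ≤ m + k ∧ q = (H m x, H n y)}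

/-- The combing is coherent. -/
def IsCoherent (H : ℕ → Y → Y) : Prop :=
  IsEntourage {q : Y × Y | ∃ x m n, m ≤ n ∧ q = (H m (H n x), H m x)}

/-- The combing is expanding. -/
def IsExpanding (H : ℕ → Y → Y) : Prop :=
  ∃ E₀ : Set (Y × Y), IsEntourage E₀ ∧ ∀ E : Set (Y × Y), IsEntourage E → ∀ n : ℕ,
    ∃ K : Set Y, IsBounded K ∧ ∀ x ∉ K, ∀ y, (y, x) ∈ E → (H n y, H n x) ∈ E₀

end CoarseSpace

open CoarseSpace

/-! ### The combing compactification -/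

section Compactification

variable {Y Z : Type*} [TopologicalSpace Y] [CoarseSpace Y] [TopologicalSpace Z] [CoarseSpace Z]

/-- The commutative C⋆-algebra `C_H(Y)` of all bounded continuous functions `f : Y → ℂ` of vanishing
variation such that `f ∘ H n` converges to `f` in the supremum norm. -/
def combingAlgebra (H : ℕ → Y → Y) : StarSubalgebra ℂ (Y →ᵇ ℂ) where
  carrier := {f | VanishingVariation f ∧ TendstoUniformly (fun n x => f (H n x)) f atTop}
  mul_mem' := by
    rintro f g ⟨hf, hf'⟩ ⟨hg, hg'⟩
    have key : ∀ ε > 0, ∃ δ > 0, ∀ x y, ‖f x - f y‖ < δ → ‖g x - g y‖ < δ →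
        ‖f x * g x - f y * g y‖ < ε := by
      intro ε hε
      refine ⟨ε / (‖f‖ + ‖g‖ + 1), by positivity, fun x y h1 h2 => ?_⟩
      have e : f x * g x - f y * g y = (f x - f y) * g x + f y * (g x - g y) := by ring
      have b1 : ‖(f x - f y) * g x‖ ≤ ε / (‖f‖ + ‖g‖ + 1) * ‖g‖ := by
        rw [norm_mul]; gcongr; exact g.norm_coe_le_norm x
      have b2 : ‖f y * (g x - g y)‖ ≤ ‖f‖ * (ε / (‖f‖ + ‖g‖ + 1)) := by
        rw [norm_mul]; gcongr; exact f.norm_coe_le_norm y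
      have b3 : ε / (‖f‖ + ‖g‖ + 1) * ‖g‖ + ‖f‖ * (ε / (‖f‖ + ‖g‖ + 1)) < ε := by
        have : 0 < ‖f‖ + ‖g‖ + 1 := by positivity
        have e2 : ε / (‖f‖ + ‖g‖ + 1) * ‖g‖ + ‖f‖ * (ε / (‖f‖ + ‖g‖ + 1))
          = ε * ((‖f‖ + ‖g‖) / (‖f‖ + ‖g‖ + 1)) := by field_simp; ring
        rw [e2]
        have : (‖f‖ + ‖g‖) / (‖f‖ + ‖g‖ + 1) < 1 := by rw [div_lt_one this]; linarith
        nlinarith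
      rw [e]
      exact (norm_add_le _ _).trans_lt ((add_le_add b1 b2).trans_lt b3)
    constructor
    · intro E hE ε hε
      obtain ⟨δ, hδ, hk⟩ := key ε hε
      obtain ⟨K, hK, h1⟩ := hf E hE δ hδ
      obtain ⟨L, hL, h2⟩ := hg E hE δ hδ
      refine ⟨K ∪ L, isBounded_union hK hL, fun x y hxy hx => ?_⟩
      rw [mem_union, not_or] at hx
      simpa using hk x y (h1 x y hxy hx.1) (h2 x y hxy hx.2)
    · rw [Metric.tendstoUniformly_iff] at hf' hg' ⊢
      intro ε hε
      obtain ⟨δ, hδ, hk⟩ := key ε hε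
      filter_upwards [hf' δ hδ, hg' δ hδ] with n h1 h2 x
      simp only [dist_eq_norm] at h1 h2 ⊢
      simpa using hk x (H n x) (h1 x) (h2 x)
  add_mem' := by
    rintro f g ⟨hf, hf'⟩ ⟨hg, hg'⟩
    have key : ∀ x y ε, ‖f x - f y‖ < ε / 2 → ‖g x - g y‖ < ε / 2 →
        ‖(f x + g x) - (f y + g y)‖ < ε := by
      intro x y ε h1 h2
      rw [add_sub_add_comm]
      exact (norm_add_le _ _).trans_lt (by linarith)
    constructor
    · intro E hE ε hε
      obtain ⟨K, hK, h1⟩ := hf E hE (ε / 2) (by positivity)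
      obtain ⟨L, hL, h2⟩ := hg E hE (ε / 2) (by positivity)
      refine ⟨K ∪ L, isBounded_union hK hL, fun x y hxy hx => ?_⟩
      rw [mem_union, not_or] at hx
      simpa using key x y ε (h1 x y hxy hx.1) (h2 x y hxy hx.2)
    · rw [Metric.tendstoUniformly_iff] at hf' hg' ⊢
      intro ε hε
      filter_upwards [hf' (ε / 2) (by positivity), hg' (ε / 2) (by positivity)] with n h1 h2 x
      simp only [dist_eq_norm] at h1 h2 ⊢
      simpa using key x (H n x) ε (h1 x) (h2 x)
  algebraMap_mem' := by
    intro c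
    constructor
    · intro E hE ε hε
      refine ⟨∅, subset diag (by simp), fun x y _ _ => ?_⟩
      simpa using hε
    · rw [Metric.tendstoUniformly_iff]
      intro ε hε
      refine Eventually.of_forall fun n x => ?_
      simpa using hε
  star_mem' := by
    rintro f ⟨hf, hf'⟩
    constructor
    · intro E hE ε hε
      obtain ⟨K, hK, h⟩ := hf E hE ε hε
      refine ⟨K, hK, fun x y hxy hx => ?_⟩
      rw [BoundedContinuousFunction.star_apply, BoundedContinuousFunction.star_apply, ← star_sub,
        norm_star]
      exact h x y hxy hx
    · rw [Metric.tendstoUniformly_iff] at hf' ⊢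
      intro ε hε
      filter_upwards [hf' ε hε] with n h x
      rw [BoundedContinuousFunction.star_apply, BoundedContinuousFunction.star_apply, dist_eq_norm,
        ← star_sub, norm_star, ← dist_eq_norm]
      exact h x

theorem mem_combingAlgebra {H : ℕ → Y → Y} {f : Y →ᵇ ℂ} : f ∈ combingAlgebra H ↔
    VanishingVariation f ∧ TendstoUniformly (fun n x => f (H n x)) f atTop := Iff.rfl

theorem isClosed_combingAlgebra (H : ℕ → Y → Y) :
    IsClosed (combingAlgebra H : Set (Y →ᵇ ℂ)) := by
  rw [← isSeqClosed_iff_isClosed]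
  intro u f hu hlim
  have key : ∀ ε > 0, ∃ g ∈ combingAlgebra H, ∀ x y, ‖g x - g y‖ < ε / 3 → ‖f x - f y‖ < ε := by
    intro ε hε
    obtain ⟨n, hn⟩ := ((Metric.tendsto_nhds.1 hlim) (ε / 3) (by positivity)).exists
    refine ⟨u n, hu n, fun x y h => ?_⟩
    have h1 : dist (u n x) (f x) < ε / 3 := (dist_coe_le_dist x).trans_lt hn
    have h2 : dist (u n y) (f y) < ε / 3 := (dist_coe_le_dist y).trans_lt hn
    rw [← dist_eq_norm] at h ⊢
    have := dist_triangle4 (f x) (u n x) (u n y) (f y)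
    rw [dist_comm (f x) (u n x)] at this
    linarith
  constructor
  · intro E hE ε hε
    obtain ⟨g, hg, h⟩ := key ε hε
    obtain ⟨K, hK, hK'⟩ := hg.1 E hE (ε / 3) (by positivity)
    exact ⟨K, hK, fun x y hxy hx => h x y (hK' x y hxy hx)⟩
  · rw [Metric.tendstoUniformly_iff]
    intro ε hε
    obtain ⟨g, hg, h⟩ := key ε hε
    filter_upwards [Metric.tendstoUniformly_iff.1 hg.2 (ε / 3) (by positivity)] with n hn x
    rw [dist_eq_norm]
    exact h x (H n x) (by rw [← dist_eq_norm]; exact hn x)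

instance completeSpace_combingAlgebra (H : ℕ → Y → Y) : CompleteSpace (combingAlgebra H) :=
  (isClosed_combingAlgebra H).completeSpace_coe

/-- The combing compactification of `(Y, H)`: the maximal ideal space of `C_H(Y)`. -/
abbrev CombingCompactification (H : ℕ → Y → Y) : Type _ :=
  WeakDual.characterSpace ℂ (combingAlgebra H)

/-- The point of the compactification given by a point of the space. -/
noncomputable def CombingCompactification.point (H : ℕ → Y → Y) (y : Y) :
    CombingCompactification H :=
  WeakDual.CharacterSpace.equivAlgHom.symm
    { toFun := fun f => f.1 y
      map_one' := rfl
      map_mul' := fun _ _ => rfl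
      map_zero' := rfl
      map_add' := fun _ _ => rfl
      commutes' := fun _ => rfl }

/-- The combing corona of `(Y, H)`: the characters of `C_H(Y)` that vanish on `C_0(Y)`, i.e. the
maximal ideal space of `C_H(Y) / C_0(Y)`. -/
def combingCorona (H : ℕ → Y → Y) : Set (CombingCompactification H) :=
  {φ | ∀ f : combingAlgebra H, VanishesAtInfinity (f : Y →ᵇ ℂ) → φ f = 0}

/-- `α` is a continuous coarse (i.e. controlled and proper) map that intertwines `H` and `G`. -/
structure IsCombedMap (H : ℕ → Y → Y) (G : ℕ → Z → Z) (α : Y → Z) : Prop where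
  continuous : Continuous α
  controlled : ∀ E : Set (Y × Y), IsEntourage E → IsEntourage (Prod.map α α '' E)
  proper : ∀ B : Set Z, IsBounded B → IsBounded (α ⁻¹' B)
  comm : ∀ n y, α (H n y) = G n (α y)

variable {H : ℕ → Y → Y} {G : ℕ → Z → Z} {α : Y → Z}

/-- Composition with `α`, as a map `C_G(Z) → C_H(Y)`. -/
noncomputable def IsCombedMap.pullback (h : IsCombedMap H G α) : combingAlgebra G →⋆ₐ[ℂ] combingAlgebra H where
  toFun f := ⟨(f : Z →ᵇ ℂ).compContinuous ⟨α, h.continuous⟩, by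
    constructor
    · intro E hE ε hε
      obtain ⟨K, hK, h1⟩ := f.2.1 _ (h.controlled E hE) ε hε
      exact ⟨_, h.proper K hK, fun x y hxy hx => h1 (α x) (α y) ⟨(x, y), hxy, rfl⟩ hx⟩
    · rw [Metric.tendstoUniformly_iff]
      intro ε hε
      filter_upwards [Metric.tendstoUniformly_iff.1 f.2.2 ε hε] with n hn y
      have := hn (α y)
      rw [← h.comm] at this
      exact this⟩
  map_one' := rfl
  map_mul' _ _ := rfl
  map_zero' := rfl
  map_add' _ _ := rfl
  commutes' _ := rfl
  map_star' _ := rfl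

/-- The continuous map of combing compactifications induced by `α`. -/
noncomputable def IsCombedMap.map (h : IsCombedMap H G α) :
    C(CombingCompactification H, CombingCompactification G) :=
  WeakDual.CharacterSpace.compContinuousMap h.pullback

end Compactification

/-! ### Rips complexes -/

/-- The geometric realization of the Rips complex `P_R(X)`: its points are given by their
barycentric coordinates, and a finite set of vertices spans a simplex if and only if its points have
mutual distance at most `R`. -/
structure RipsComplex (X : Type*) [MetricSpace X] (R : ℝ≥0) where
  coord : X →₀ ℝ
  nonneg : ∀ x, 0 ≤ coord x
  sum_eq_one : (coord.sum fun _ a => a) = 1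
  dist_le : ∀ x ∈ coord.support, ∀ y ∈ coord.support, dist x y ≤ R

namespace RipsComplex

variable {X : Type*} [MetricSpace X] {R S : ℝ≥0}

/-- The topology of pointwise convergence of the barycentric coordinates. When `X` is proper and
discrete, the complex is locally finite and this is the weak topology, see `isOpen_iff`. -/
instance : TopologicalSpace (RipsComplex X R) :=
  TopologicalSpace.induced (fun w x => w.coord x) inferInstance

theorem support_nonempty (w : RipsComplex X R) : w.coord.support.Nonempty := by
  rw [Finset.nonempty_iff_ne_empty]
  intro h
  have h1 := w.sum_eq_one
  rw [Finsupp.support_eq_empty.1 h, Finsupp.sum_zero_index] at h1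
  exact zero_ne_one h1

/-- A set is open if and only if its trace on every (finite) simplex is open, where a simplex carries
the Euclidean topology of the barycentric coordinates. -/
theorem isOpen_iff [ProperSpace X] [DiscreteTopology X] {U : Set (RipsComplex X R)} :
    IsOpen U ↔ ∀ s : Finset X,
      IsOpen ((↑) ⁻¹' U : Set {w : RipsComplex X R // w.coord.support ⊆ s}) := by
  refine ⟨fun h s => h.preimage continuous_subtype_val, fun h => isOpen_iff_mem_nhds.2 fun w hw => ?_⟩
  obtain ⟨v, hv⟩ := w.support_nonempty
  have hfin : (Metric.closedBall v (R : ℝ)).Finite :=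
    (isCompact_closedBall v (R : ℝ)).finite_of_discrete
  obtain ⟨V, hV, hVU⟩ := isOpen_induced_iff.1 (h hfin.toFinset)
  have hsub : ∀ w' : RipsComplex X R, v ∈ w'.coord.support →
      w'.coord.support ⊆ hfin.toFinset := fun w' hw' x hx => by
    rw [Set.Finite.mem_toFinset, Metric.mem_closedBall]
    exact w'.dist_le x hx v hw'
  have hmem : ∀ (w' : RipsComplex X R) (_ : v ∈ w'.coord.support), w' ∈ V ↔ w' ∈ U := by
    intro w' hw'
    exact Set.ext_iff.1 hVU ⟨w', hsub w' hw'⟩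
  have hO : IsOpen {w' : RipsComplex X R | w'.coord v ≠ 0} := by
    have hc : Continuous fun w' : RipsComplex X R => w'.coord v :=
      (continuous_apply v).comp continuous_induced_dom
    exact isOpen_ne.preimage hc
  have hv' : w.coord v ≠ 0 := Finsupp.mem_support_iff.1 hv
  filter_upwards [hV.mem_nhds ((hmem w hv).2 hw), hO.mem_nhds hv'] with w' h1 h2
  exact (hmem w' (Finsupp.mem_support_iff.2 h2)).1 h1

/-- The canonical coarse structure of the Rips complex: two points count as close if the vertices of
the simplices that carry them are close in `X`. -/
instance : CoarseSpace (RipsComplex X R) where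
  IsEntourage E := ∃ r : ℝ, ∀ q ∈ E, ∀ v ∈ q.1.coord.support, ∀ w ∈ q.2.coord.support, dist v w ≤ r
  diag := ⟨R, fun q hq v hv w hw => by
    rw [Set.mem_ofPred_eq] at hq
    rw [← hq] at hw
    exact q.1.dist_le v hv w hw⟩
  subset := fun ⟨r, hr⟩ h => ⟨r, fun q hq => hr q (h hq)⟩
  union := fun ⟨r, hr⟩ ⟨s, hs⟩ => ⟨max r s, fun q hq v hv w hw => hq.elim
    (fun h => (hr q h v hv w hw).trans (le_max_left _ _))
    fun h => (hs q h v hv w hw).trans (le_max_right _ _)⟩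
  inv := fun ⟨r, hr⟩ => ⟨r, fun q hq v hv w hw => by rw [dist_comm]; exact hr _ hq w hw v hv⟩
  comp := fun ⟨r, hr⟩ ⟨s, hs⟩ => ⟨r + s, fun q ⟨z, h1, h2⟩ v hv w hw => by
    obtain ⟨u, hu⟩ := z.support_nonempty
    exact (dist_triangle _ u _).trans (add_le_add (hr _ h1 v hv u hu) (hs _ h2 u hu w hw))⟩
  connected x y := by
    obtain ⟨u, hu⟩ := x.support_nonempty
    obtain ⟨u', hu'⟩ := y.support_nonempty
    refine ⟨R + dist u u' + R, fun q hq v hv w hw => ?_⟩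
    rw [mem_singleton_iff] at hq
    subst hq
    exact (dist_triangle4 v u u' w).trans
      (by gcongr; exacts [x.dist_le v hv u hu, y.dist_le u' hu' w hw])

/-- The inclusion `X ⊆ P_R(X)`. -/
noncomputable def vertex (R : ℝ≥0) (x : X) : RipsComplex X R where
  coord := Finsupp.single x 1
  nonneg y := by
    classical
    rw [Finsupp.single_apply]; split_ifs <;> simp
  sum_eq_one := Finsupp.sum_single_index rfl
  dist_le y hy z hz := by
    have h1 := Finsupp.support_single_subset hy
    have h2 := Finsupp.support_single_subset hz
    rw [Finset.mem_singleton] at h1 h2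
    rw [h1, h2, dist_self]
    exact R.2

/-- The inclusion `P_R(X) ⊆ P_S(X)` for `R ≤ S`. -/
def incl (h : R ≤ S) (w : RipsComplex X R) : RipsComplex X S :=
  ⟨w.coord, w.nonneg, w.sum_eq_one, fun x hx y hy => (w.dist_le x hx y hy).trans (by exact_mod_cast h)⟩

/-- A vertex of the simplex that carries `w`. -/
noncomputable def carrier (w : RipsComplex X R) : X := w.support_nonempty.choose

theorem carrier_mem (w : RipsComplex X R) : w.carrier ∈ w.coord.support :=
  w.support_nonempty.choose_spec

theorem support_vertex (x : X) : (vertex R x).coord.support = {x} :=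
  Finsupp.support_single _ one_ne_zero

theorem carrier_vertex (x : X) : (vertex R x).carrier = x := by
  have := (vertex R x).carrier_mem
  rwa [support_vertex, Finset.mem_singleton] at this

open Classical in
/-- The combing of `P_R(X)` obtained from a combing `H` of `X` through the coarse equivalence
`X ⊆ P_R(X)`. It extends `H` and moves a point along with a vertex of its simplex. Every other
combing of `P_R(X)` whose restriction to `X` is close to `H` is close to this one, and therefore
defines the same compactification if `H` is proper. -/
noncomputable def combing (H : ℕ → X → X) (n : ℕ) (w : RipsComplex X R) : RipsComplex X R :=
  if n ≠ 0 ∧ H n w.carrier = w.carrier then w else vertex R (H n w.carrier)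

theorem combing_vertex (H : ℕ → X → X) (n : ℕ) (x : X) :
    combing H n (vertex R x) = vertex R (H n x) := by
  unfold combing
  rw [carrier_vertex]
  split_ifs with h
  · rw [h.2]
  · rfl

theorem isBounded_image_carrier {B : Set (RipsComplex X R)} (hB : CoarseSpace.IsBounded B) :
    CoarseSpace.IsBounded (carrier '' B) := by
  obtain ⟨r, hr⟩ := hB
  refine ⟨r, ?_⟩
  rintro ⟨_, _⟩ ⟨⟨w, hw, rfl⟩, ⟨w', hw', rfl⟩⟩
  exact hr (w, w') ⟨hw, hw'⟩ _ w.carrier_mem _ w'.carrier_mem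

/-- The map `combing H` is indeed a combing. -/
theorem isCombing_combing {p : X} {H : ℕ → X → X} (hH : IsCombing p H) :
    IsCombing (vertex R p) (combing (R := R) H) where
  zero w := by
    unfold combing
    rw [if_neg (by simp), hH.zero]
  base n := by rw [combing_vertex, hH.base]
  eventually_id K hK := by
    obtain ⟨N, hN⟩ := hH.eventually_id _ (isBounded_image_carrier hK)
    refine ⟨N + 1, fun n hn w hw => ?_⟩
    unfold combing
    exact if_pos ⟨by omega, hN n (by omega) _ ⟨w, hw, rfl⟩⟩
  controlled E hE k := by
    obtain ⟨r, hr⟩ := hE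
    obtain ⟨s, hs⟩ := hH.controlled {q : X × X | dist q.1 q.2 ≤ r} ⟨r, fun q hq => hq⟩ k
    have near : ∀ (n : ℕ) (w : RipsComplex X R), ∀ v ∈ (combing H n w).coord.support,
        dist v (H n w.carrier) ≤ R := by
      intro n w v hv
      unfold combing at hv
      split_ifs at hv with h
      · rw [h.2]
        exact w.dist_le _ hv _ w.carrier_mem
      · rw [support_vertex, Finset.mem_singleton] at hv
        rw [hv, dist_self]
        exact R.2
    refine ⟨R + s + R, ?_⟩
    rintro _ ⟨x, y, m, n, hxy, hmn, hnm, rfl⟩ v hv w hw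
    have h1 := near m x v hv
    have h2 := near n y w hw
    have h3 := hs (H m x.carrier, H n y.carrier) ⟨_, _, m, n,
      hr (x, y) hxy _ x.carrier_mem _ y.carrier_mem, hmn, hnm, rfl⟩
    rw [dist_comm] at h2
    exact (dist_triangle4 v _ _ w).trans (by gcongr)

theorem isCombedMap_vertex [DiscreteTopology X] (H : ℕ → X → X) (R : ℝ≥0) :
    IsCombedMap H (combing H) (vertex (X := X) R) where
  continuous := continuous_of_discreteTopology
  controlled := by
    rintro E ⟨r, hr⟩
    refine ⟨r, ?_⟩
    rintro _ ⟨⟨x, y⟩, hxy, rfl⟩ v hv w hw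
    simp only [Prod.map, support_vertex, Finset.mem_singleton] at hv hw
    rw [hv, hw]
    exact hr _ hxy
  proper := by
    rintro B ⟨r, hr⟩
    refine ⟨r, ?_⟩
    rintro ⟨x, y⟩ ⟨hx, hy⟩
    exact hr (vertex R x, vertex R y) ⟨hx, hy⟩ x (by simp [support_vertex]) y
      (by simp [support_vertex])
  comm n x := (combing_vertex H n x).symm

theorem isCombedMap_incl (H : ℕ → X → X) (h : R ≤ S) :
    IsCombedMap (combing H) (combing H) (incl (X := X) h) where
  continuous := continuous_induced_rng.2 continuous_induced_dom
  controlled := by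
    rintro E ⟨r, hr⟩
    refine ⟨r, ?_⟩
    rintro _ ⟨q, hq, rfl⟩
    exact hr q hq
  proper := by
    rintro B ⟨r, hr⟩
    refine ⟨r, ?_⟩
    rintro ⟨x, y⟩ ⟨hx, hy⟩
    exact hr (incl h x, incl h y) ⟨hx, hy⟩
  comm n w := by
    have hc : (incl h w).carrier = w.carrier := rfl
    unfold combing
    rw [hc]
    split_ifs <;> rfl

end RipsComplex

/-! ### The `σ`-compact space of all compactified Rips complexes -/

section Sigma

variable {X : Type*} [MetricSpace X]

/-- The combing compactification of `P_R(X)`. -/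
abbrev RipsCompactification (H : ℕ → X → X) (R : ℝ≥0) : Type _ :=
  CombingCompactification (RipsComplex.combing (R := R) H)

/-- The map from the compactification of `P_R(X)` to that of `P_S(X)` that extends
`P_R(X) ⊆ P_S(X)`. -/
noncomputable def RipsCompactification.incl (H : ℕ → X → X) {R S : ℝ≥0} (h : R ≤ S) :
    C(RipsCompactification H R, RipsCompactification H S) :=
  (RipsComplex.isCombedMap_incl H h).map

/-- The transition maps between the compactifications at integral scales. -/
noncomputable def RipsCompactification.transition (H : ℕ → X → X) (m n : ℕ) (h : m ≤ n) :
    C(RipsCompactification H (m : ℝ≥0), RipsCompactification H (n : ℝ≥0)) :=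
  RipsCompactification.incl H (Nat.cast_le.2 h)

instance (H : ℕ → X → X) : DirectedSystem (fun n : ℕ => RipsCompactification H (n : ℝ≥0))
    (RipsCompactification.transition H · · ·) where
  map_self _ _ := WeakDual.CharacterSpace.ext fun _ => rfl
  map_map _ _ _ _ _ _ := WeakDual.CharacterSpace.ext fun _ => rfl

/-- The union over all `n` of the combing compactifications of `P_n(X)`, with the final topology
(Mathlib's topology on a quotient of a disjoint union). -/
abbrev FullRipsCompactification (H : ℕ → X → X) : Type _ :=
  DirectLimit (fun n : ℕ => RipsCompactification H (n : ℝ≥0)) (RipsCompactification.transition H)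

/-- The canonical map from the compactification of `P_n(X)` to the union. -/
noncomputable def FullRipsCompactification.of (H : ℕ → X → X) (n : ℕ)
    (φ : RipsCompactification H (n : ℝ≥0)) : FullRipsCompactification H :=
  Quotient.mk _ ⟨n, φ⟩

/-- The `n`-th step of the filtration of the union. -/
def FullRipsCompactification.step (H : ℕ → X → X) (n : ℕ) : Set (FullRipsCompactification H) :=
  range (FullRipsCompactification.of H n)

/-- The full Rips complex, i.e. the union of all `P_n(X)`, as a subset of the union of the
compactifications. -/
def FullRipsCompactification.rips (H : ℕ → X → X) : Set (FullRipsCompactification H) :=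
  {z | ∃ (n : ℕ) (w : RipsComplex X (n : ℝ≥0)),
    z = FullRipsCompactification.of H n (CombingCompactification.point _ w)}

/-- The map from the combing corona of `(X, H)` to the union of the compactifications of the
`P_n(X)`, induced by `X ⊆ P_0(X)`. -/
noncomputable def FullRipsCompactification.coronaMap [DiscreteTopology X] (H : ℕ → X → X)
    (φ : combingCorona H) : FullRipsCompactification H :=
  FullRipsCompactification.of H 0
    ((RipsComplex.isCombedMap_vertex H ((0 : ℕ) : ℝ≥0)).map (φ : CombingCompactification H))

end Sigma

/-- Let `Y` be filtered by the subsets `F 0 ⊆ F 1 ⊆ …`. Then `Y` is contractible as a filtered space: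
there is a contraction to a point that maps each `F m × [0,1]` into some `F n`. -/
def IsSigmaContractible {Y : Type*} [TopologicalSpace Y] (F : ℕ → Set Y) : Prop :=
  ∃ (y₀ : Y) (h : (ContinuousMap.id Y).Homotopy (ContinuousMap.const Y y₀)),
    ∀ m : ℕ, ∃ n : ℕ, ∀ t : I, ∀ y ∈ F m, h (t, y) ∈ F n

/-- `Z` is a Z-set in `Y`: it is closed, and there is a homotopy from the identity of `Y` that moves
`Y` off `Z` at all positive times. -/
def IsZSet {Y : Type*} [TopologicalSpace Y] (Z : Set Y) : Prop :=
  IsClosed Z ∧ ∃ h : C(I × Y, Y), (∀ y, h (0, y) = y) ∧ ∀ t : I, 0 < t → ∀ y, h (t, y) ∉ Z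

/-! ### Partitions of unity subordinate to a countably generated uniformity -/

-- The combing itself ought to contract the Rips complex: slide every point back along its path to
-- `p`. But `H n` is discontinuous at the corona, so it is first smoothed into maps with values in
-- probability measures.
--
-- The smoothing uses a uniformity on `X`. A pair is small of order `n` if its points coincide, or
-- if both lie outside the `n`-ball about `p` and their paths stay `C`-close up to time `n`.
-- Expansion together with coherence makes one constant `C` reproduce itself under composition, and
-- uniformly continuous functions satisfy the two conditions that define `C_H(X)`
-- (`exists_combingEntourage_constant`). The uniformity has a countable basis, hence is
-- pseudometrizable, and `H n` has finite range. So there is a uniformly continuous partition of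
-- unity subordinate to thickened fibres of `H n`. It assigns to `x` a measure `G n x` near `H n x`
-- whose weights belong to `C_H(X)` (`exists_isSmoothing`).
--
-- Interpolating `G` in time and extending affinely over simplices gives maps `slide` from `P_R(X)`
-- to `P_S(X)`. At a fixed time the image lies in a finite subcomplex, so composition with a
-- continuous function is controlled by finitely many weights and stays in the combing algebra. As
-- time tends to infinity, `f ∘ slide` converges uniformly to `f` for every `f` in `C_H(P_S(X))`
-- (`exists_forall_norm_slide_sub_le`). Dually, this is a homotopy of maximal ideal spaces from the
-- inclusion to a constant (`isCombedHomotopy`). At positive times it avoids the corona, because a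
-- function in `C_0` is `1` on the finite subcomplex (`map_notMem_combingCorona`).
--
-- Modulo `C_0`, a function on `P_R(X)` is the affine extension of its restriction to `X`. Hence all
-- scales have the corona of `X`, and the remaining characters are points of the complex; this
-- yields the embeddings. The homotopies depend neither on source scale nor on target scale, so they
-- glue on the union.

theorem abs_div_sub_div_le {a b a' b' : ℝ} (hb : 1 ≤ b) (ha' : 0 ≤ a') (hab : a' ≤ b')
    (hb' : 1 ≤ b') : |a / b - a' / b'| ≤ |a - a'| + |b - b'| := by
  have h0 : (0 : ℝ) < b := by linarith
  have h0' : (0 : ℝ) < b' := by linarith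
  have e : a / b - a' / b' = (a - a') / b + (a' / b') * ((b' - b) / b) := by
    field_simp; ring
  rw [e]
  refine (abs_add_le _ _).trans (add_le_add ?_ ?_)
  · rw [abs_div, abs_of_pos h0]
    exact div_le_self (abs_nonneg _) hb
  · rw [abs_mul, abs_div, abs_div, abs_of_pos h0, abs_of_pos h0', abs_of_nonneg ha',
      abs_sub_comm b' b]
    calc a' / b' * (|b - b'| / b) ≤ 1 * |b - b'| := by
          gcongr
          · exact (div_le_one h0').2 hab
          · exact div_le_self (abs_nonneg _) hb
      _ = _ := one_mul _

/-- Let `q` have finite range. Then there is a uniformly continuous partition of unity that is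
indexed by the values of `q` and subordinate to the `δ`-thickenings of the fibres of `q`. -/
theorem exists_subordinate_partition_of_pseudoMetric {α β : Type*} [PseudoMetricSpace α]
    (q : α → β) (hq : (range q).Finite) {δ : ℝ} (hδ : 0 < δ) :
    ∃ μ : α → β →₀ ℝ, (∀ x z, 0 ≤ μ x z) ∧ (∀ x, ((μ x).sum fun _ a => a) = 1) ∧
      (∀ x, (μ x).support ⊆ hq.toFinset) ∧
      (∀ x, ∀ z ∈ (μ x).support, ∃ y, q y = z ∧ dist x y < δ) ∧
      ∀ ε > 0, ∃ η > 0, ∀ x y, dist x y < η → ∀ z, |μ x z - μ y z| < ε := by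
  classical
  set B := hq.toFinset with hB
  -- Each `φ z` is Lipschitz and equals `1` on the fibre over `z`. Hence the sum `Φ` is at least
  -- `1`, and dividing by it preserves uniform continuity.
  let φ : β → α → ℝ := fun z x => thickenedIndicator hδ (q ⁻¹' {z}) x
  have hφ0 : ∀ z x, 0 ≤ φ z x := fun z x => NNReal.coe_nonneg _
  have hφ1 : ∀ x, φ (q x) x = 1 := fun x => by
    simp only [φ]
    rw [thickenedIndicator_one hδ _ (by simp)]; rfl
  have hφU : ∀ z x, φ z x ≠ 0 → ∃ y, q y = z ∧ dist x y < δ := by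
    intro z x h
    by_contra hc
    refine h ?_
    have : x ∉ Metric.thickening δ (q ⁻¹' {z}) := by
      rw [Metric.mem_thickening_iff]
      rintro ⟨y, hy, hxy⟩
      exact hc ⟨y, hy, hxy⟩
    simp only [φ]
    rw [thickenedIndicator_zero hδ _ this]; rfl
  have hmem : ∀ x, q x ∈ B := fun x => by simp [hB]
  let Φ : α → ℝ := fun x => ∑ z ∈ B, φ z x
  have hΦle : ∀ x, ∀ z ∈ B, φ z x ≤ Φ x := fun x z hz =>
    Finset.single_le_sum (f := fun z => φ z x) (fun z _ => hφ0 z x) hz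
  have hΦ1 : ∀ x, 1 ≤ Φ x := fun x => by
    rw [← hφ1 x]
    exact hΦle x _ (hmem x)
  have hnot : ∀ x z, φ z x / Φ x ≠ 0 → z ∈ B := by
    intro x z h
    obtain ⟨y, rfl, -⟩ := hφU z x (fun h0 => h (by rw [h0, zero_div]))
    exact hmem y
  have hφuc : ∀ ε > 0, ∃ η > 0, ∀ x y, dist x y < η → ∀ z ∈ B, |φ z x - φ z y| < ε := by
    intro ε hε
    have h1 : ∀ z ∈ B, ∀ᶠ p in uniformity α, |φ z p.1 - φ z p.2| < ε := by
      intro z _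
      obtain ⟨η, hη, h⟩ := Metric.uniformContinuous_iff.1
        (lipschitzWith_thickenedIndicator hδ (q ⁻¹' {z})).uniformContinuous ε hε
      exact Filter.mem_of_superset (Metric.dist_mem_uniformity hη) fun p hp => h hp
    obtain ⟨η, hη, h⟩ := Metric.mem_uniformity_dist.1 ((Finset.eventually_all B).2 h1)
    exact ⟨η, hη, fun x y hxy => h hxy⟩
  refine ⟨fun x => Finsupp.onFinset B (fun z => φ z x / Φ x) (hnot x), ?_, ?_, ?_, ?_, ?_⟩
  · intro x z
    exact div_nonneg (hφ0 z x) (zero_le_one.trans (hΦ1 x))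
  · intro x
    rw [Finsupp.onFinset_sum _ (fun _ => rfl), ← Finset.sum_div]
    exact div_self (by have := hΦ1 x; positivity)
  · intro x
    exact Finsupp.support_onFinset_subset
  · intro x z hz
    rw [Finsupp.mem_support_iff, Finsupp.onFinset_apply] at hz
    exact hφU z x (fun h0 => hz (by rw [h0, zero_div]))
  · intro ε hε
    -- The difference of the quotients is bounded by one difference of numerators plus `B.card`
    -- further ones from `Φ`, so `B.card + 2` leaves strict room.
    obtain ⟨η, hη, hN⟩ := hφuc (ε / (B.card + 2)) (by positivity)
    refine ⟨η, hη, fun x y hxy z => ?_⟩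
    rw [Finsupp.onFinset_apply, Finsupp.onFinset_apply]
    by_cases hz : z ∈ B
    · refine (abs_div_sub_div_le (hΦ1 x) (hφ0 z y) (hΦle y z hz) (hΦ1 y)).trans_lt ?_
      have h1 : |Φ x - Φ y| ≤ B.card * (ε / (B.card + 2)) := by
        simp only [Φ]
        rw [← Finset.sum_sub_distrib, ← nsmul_eq_mul]
        exact (Finset.abs_sum_le_sum_abs _ _).trans
          (Finset.sum_le_card_nsmul _ _ _ fun z hz => (hN x y hxy z hz).le)
      have h2 := hN x y hxy z hz
      have h3 : ε / (B.card + 2) + B.card * (ε / (B.card + 2)) < ε := by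
        have h4 : ε / (B.card + 2) * (B.card + 2) = ε := by field_simp
        have h5 : 0 < ε / ((B.card : ℝ) + 2) := by positivity
        nlinarith
      linarith
    · have h1 : φ z x / Φ x = 0 := by_contra fun h => hz (hnot x z h)
      have h2 : φ z y / Φ y = 0 := by_contra fun h => hz (hnot y z h)
      rw [h1, h2]
      simpa using hε

/-- The variant of `exists_subordinate_partition_of_pseudoMetric` for the uniformity with the
countable basis `U`. -/
theorem exists_subordinate_partition {α β : Type*} (U : ℕ → Set (α × α))
    (hrefl : ∀ n x, (x, x) ∈ U n) (hsymm : ∀ n x y, (x, y) ∈ U n → (y, x) ∈ U n)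
    (hanti : Antitone U)
    (hcomp : ∀ n, ∃ N, ∀ x y z, (x, y) ∈ U N → (y, z) ∈ U N → (x, z) ∈ U n)
    (q : α → β) (hq : (range q).Finite) (n : ℕ) :
    ∃ μ : α → β →₀ ℝ, (∀ x z, 0 ≤ μ x z) ∧ (∀ x, ((μ x).sum fun _ a => a) = 1) ∧
      (∀ x, (μ x).support ⊆ hq.toFinset) ∧
      (∀ x, ∀ z ∈ (μ x).support, ∃ y, q y = z ∧ (x, y) ∈ U n) ∧
      ∀ ε > 0, ∃ N, ∀ x y, (x, y) ∈ U N → ∀ z, |μ x z - μ y z| < ε := by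
  have hbasis : (⨅ n, 𝓟 (U n)).HasBasis (fun _ => True) U :=
    hasBasis_iInf_principal (directed_of_isDirected_le fun i j h => hanti h)
  let core : UniformSpace.Core α := UniformSpace.Core.mk' (⨅ n, 𝓟 (U n))
    (fun r hr x => by
      obtain ⟨n, -, hn⟩ := hbasis.mem_iff.1 hr
      exact hn (hrefl n x))
    (fun r hr => by
      obtain ⟨n, -, hn⟩ := hbasis.mem_iff.1 hr
      exact hbasis.mem_iff.2 ⟨n, trivial, fun p hp => hn (hsymm n p.1 p.2 hp)⟩)
    (fun r hr => by
      obtain ⟨n, -, hn⟩ := hbasis.mem_iff.1 hr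
      obtain ⟨N, hN⟩ := hcomp n
      refine ⟨U N, hbasis.mem_iff.2 ⟨N, trivial, Subset.rfl⟩, ?_⟩
      rintro ⟨x, z⟩ ⟨y, hxy, hyz⟩
      exact hn (hN x y z hxy hyz))
  let _ : UniformSpace α := UniformSpace.ofCore core
  have hU : (uniformity α).HasBasis (fun _ => True) U := hbasis
  have : (uniformity α).IsCountablyGenerated := hU.isCountablyGenerated
  -- A countably generated uniformity is pseudometrizable; `δ` is then chosen so that `δ`-close
  -- pairs lie in `U n`.
  let _ : PseudoMetricSpace α := UniformSpace.pseudoMetricSpace α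
  obtain ⟨δ, hδ, hδU⟩ := Metric.mem_uniformity_dist.1 (hU.mem_of_mem (i := n) trivial)
  obtain ⟨μ, h1, h2, h3, h4, h5⟩ := exists_subordinate_partition_of_pseudoMetric q hq hδ
  refine ⟨μ, h1, h2, h3, fun x z hz => ?_, fun ε hε => ?_⟩
  · obtain ⟨y, hy, hxy⟩ := h4 x z hz
    exact ⟨y, hy, hδU hxy⟩
  · obtain ⟨η, hη, h⟩ := h5 ε hε
    obtain ⟨N, -, hN⟩ := hU.mem_iff.1 (Metric.dist_mem_uniformity hη)
    exact ⟨N, fun x y hxy => h x y (hN hxy)⟩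

/-! ### Metric form of the axioms of a combing -/

section MetricCombing

variable {X : Type*} [MetricSpace X] {p : X} {H : ℕ → X → X}

theorem CoarseSpace.isBounded_iff_exists_dist_le (p : X) {K : Set X} :
    CoarseSpace.IsBounded K ↔ ∃ ρ : ℝ, ∀ x ∈ K, dist x p ≤ ρ := by
  constructor
  · rintro ⟨r, hr⟩
    rcases K.eq_empty_or_nonempty with rfl | ⟨a, ha⟩
    · exact ⟨0, by simp⟩
    · exact ⟨r + dist a p, fun x hx => (dist_triangle x a p).trans
        (by gcongr; exact hr (x, a) ⟨hx, ha⟩)⟩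
  · rintro ⟨ρ, hρ⟩
    refine ⟨ρ + ρ, ?_⟩
    rintro ⟨x, y⟩ ⟨hx, hy⟩
    exact (dist_triangle_right x y p).trans (add_le_add (hρ x hx) (hρ y hy))

theorem CoarseSpace.IsCombing.exists_dist_le (h : IsCombing p H) (r : ℝ) (k : ℕ) :
    ∃ s : ℝ, 0 ≤ s ∧ ∀ x y m n, dist x y ≤ r → m ≤ n + k → n ≤ m + k →
      dist (H m x) (H n y) ≤ s := by
  obtain ⟨s, hs⟩ := h.controlled {q | dist q.1 q.2 ≤ r} ⟨r, fun q hq => hq⟩ k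
  exact ⟨max s 0, le_max_right _ _, fun x y m n hxy hm hn =>
    (hs (H m x, H n y) ⟨x, y, m, n, hxy, hm, hn, rfl⟩).trans (le_max_left _ _)⟩

theorem CoarseSpace.IsCombing.exists_forall_eq (h : IsCombing p H) (ρ : ℝ) :
    ∃ N : ℕ, ∀ n ≥ N, ∀ x, dist x p ≤ ρ → H n x = x := by
  obtain ⟨N, hN⟩ := h.eventually_id {x | dist x p ≤ ρ}
    ((isBounded_iff_exists_dist_le p).2 ⟨ρ, fun x hx => hx⟩)
  exact ⟨N, fun n hn x hx => hN n hn x hx⟩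

theorem CoarseSpace.IsCoherent.exists_dist_le (h : IsCoherent H) :
    ∃ c : ℝ, 0 ≤ c ∧ ∀ x m n, m ≤ n → dist (H m (H n x)) (H m x) ≤ c := by
  obtain ⟨c, hc⟩ := h
  exact ⟨max c 0, le_max_right _ _, fun x m n hmn =>
    (hc (H m (H n x), H m x) ⟨x, m, n, hmn, rfl⟩).trans (le_max_left _ _)⟩

/-- Only finitely many times are involved, so the largest of their radii serves them all. The
essential point is that `e` is chosen before `r` and `n`. -/
theorem CoarseSpace.IsExpanding.exists_dist_le (h : IsExpanding H) (p : X) :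
    ∃ e : ℝ, 0 ≤ e ∧ ∀ (r : ℝ) (n : ℕ), ∃ ρ : ℝ, ∀ m ≤ n, ∀ x y, ρ < dist x p → dist y x ≤ r →
      dist (H m y) (H m x) ≤ e := by
  obtain ⟨E₀, ⟨e, he⟩, h⟩ := h
  have key : ∀ (r : ℝ) (m : ℕ), ∃ ρ : ℝ, ∀ x y, ρ < dist x p → dist y x ≤ r →
      dist (H m y) (H m x) ≤ max e 0 := by
    intro r m
    obtain ⟨K, hK, hK'⟩ := h {q | dist q.1 q.2 ≤ r} ⟨r, fun q hq => hq⟩ m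
    obtain ⟨ρ, hρ⟩ := (isBounded_iff_exists_dist_le p).1 hK
    exact ⟨ρ, fun x y hx hy => (he _ (hK' x (fun hxK => (hρ x hxK).not_gt hx) y hy)).trans
      (le_max_left _ _)⟩
  refine ⟨max e 0, le_max_right _ _, fun r n => ?_⟩
  choose ρ hρ using key r
  refine ⟨(Finset.range (n + 1)).sup' ⟨0, by simp⟩ ρ, fun m hm x y hx hy =>
    hρ m x y (lt_of_le_of_lt ?_ hx) hy⟩
  exact Finset.le_sup' ρ (by simpa using Nat.lt_succ_of_le hm)

/-- A coherent combing is proper: points that are far away stay far away at late times. -/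
theorem CoarseSpace.IsCombing.exists_dist_le_of_dist_le (h : IsCombing p H) {c : ℝ}
    (hc : ∀ x m n, m ≤ n → dist (H m (H n x)) (H m x) ≤ c) (ρ : ℝ) :
    ∃ N : ℕ, ∀ n ≥ N, ∀ x, dist (H n x) p ≤ ρ → dist x p ≤ ρ + c := by
  obtain ⟨s, hs0, hs⟩ := h.exists_dist_le 0 1
  obtain ⟨N, hN⟩ := h.exists_forall_eq (ρ + c + s)
  refine ⟨N, fun n hn x hx => ?_⟩
  have hc0 : 0 ≤ c := dist_nonneg.trans (hc x 0 0 le_rfl)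
  -- One more unit of time moves the point by at most `s`, hence into the ball fixed by `H n`.
  -- Coherence then compares it with `H n x` and restores the bound `ρ + c`, so the error does not
  -- accumulate.
  have key : ∀ k, dist (H (n + k) x) p ≤ ρ + c := by
    intro k
    induction k with
    | zero => rw [add_zero]; linarith
    | succ k ih =>
      have h1 : dist (H (n + (k + 1)) x) (H (n + k) x) ≤ s :=
        hs x x _ _ (by simp) (by omega) (by omega)
      have h2 : dist (H (n + (k + 1)) x) p ≤ ρ + c + s := by
        have := dist_triangle (H (n + (k + 1)) x) (H (n + k) x) p
        linarith
      have h3 := hc x n (n + (k + 1)) (by omega)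
      rw [hN n hn _ h2] at h3
      have := dist_triangle (H (n + (k + 1)) x) (H n x) p
      linarith
  obtain ⟨M, hM⟩ := h.exists_forall_eq (dist x p)
  have := key M
  rwa [hM (n + M) (by omega) x le_rfl] at this

/-- The basic entourages of the uniformity whose completion is the combing compactification. -/
def combingEntourage (p : X) (H : ℕ → X → X) (C : ℝ) (n : ℕ) : Set (X × X) :=
  {q | q.1 = q.2 ∨ (n < dist q.1 p ∧ n < dist q.2 p ∧ ∀ m ≤ n, dist (H m q.1) (H m q.2) ≤ C)}

theorem combingEntourage_antitone (C : ℝ) : Antitone (combingEntourage p H C) := by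
  rintro m n hmn ⟨x, y⟩ (h | ⟨h1, h2, h3⟩)
  · exact Or.inl h
  · have : (m : ℝ) ≤ n := by exact_mod_cast hmn
    exact Or.inr ⟨this.trans_lt h1, this.trans_lt h2, fun k hk => h3 k (hk.trans hmn)⟩

theorem combingEntourage_symm {C : ℝ} {n : ℕ} {x y : X} (h : (x, y) ∈ combingEntourage p H C n) :
    (y, x) ∈ combingEntourage p H C n := by
  rcases h with h | ⟨h1, h2, h3⟩
  · exact Or.inl h.symm
  · exact Or.inr ⟨h2, h1, fun m hm => by rw [dist_comm]; exact h3 m hm⟩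

/-- For a suitable constant `C`, the `combingEntourage`s are the basis of a uniformity, and functions
that are uniformly continuous with respect to it have vanishing variation and are the uniform limits
of their pullbacks under the combing. -/
theorem exists_combingEntourage_constant (hcomb : IsCombing p H) (hcoh : IsCoherent H)
    (hexp : IsExpanding H) : ∃ C : ℝ, 0 ≤ C ∧
      (∀ n, ∃ N, ∀ x y z, (x, y) ∈ combingEntourage p H C N → (y, z) ∈ combingEntourage p H C N →
        (x, z) ∈ combingEntourage p H C n) ∧
      ∀ f : X → ℂ, (∀ ε > 0, ∃ n, ∀ x y, (x, y) ∈ combingEntourage p H C n → ‖f x - f y‖ < ε) →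
        VanishingVariation f ∧ TendstoUniformly (fun n x => f (H n x)) f atTop := by
  obtain ⟨c, hc0, hc⟩ := hcoh.exists_dist_le
  obtain ⟨e, he0, he⟩ := hexp.exists_dist_le p
  -- Paths that are `2 * C`-close at a late time `N` are `e`-close when combed back from there to
  -- times `m ≤ n`, by expansion. Replacing `H m (H N x)` by `H m x`, and likewise for `z`, costs
  -- `c` each, by coherence. The resulting `e + 2 * c` is `C` again.
  refine ⟨e + 2 * c, by positivity, fun n => ?_, fun f hf => ⟨?_, ?_⟩⟩
  · obtain ⟨ρ, hρ⟩ := he (2 * (e + 2 * c)) n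
    obtain ⟨N₀, hN₀⟩ := hcomb.exists_dist_le_of_dist_le hc ρ
    -- Points outside the `N`-ball are outside the ball of radius `ρ + c`, so at time `N ≥ N₀` their
    -- paths are still outside the ball of radius `ρ`, where expansion applies.
    set N := max n (max N₀ ⌈ρ + c⌉₊) with hN
    have hnN : n ≤ N := le_max_left _ _
    have hN₀N : N₀ ≤ N := (le_max_left _ _).trans (le_max_right _ _)
    have hρN : ρ + c ≤ N := (Nat.le_ceil _).trans
      (by exact_mod_cast (le_max_right _ _).trans (le_max_right _ _))
    have hnN' : (n : ℝ) ≤ N := by exact_mod_cast hnN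
    refine ⟨N, fun x y z hxy hyz => ?_⟩
    rcases hxy with hxy | ⟨h1, h2, h3⟩
    · simp only at hxy
      rw [hxy]; exact combingEntourage_antitone _ hnN hyz
    rcases hyz with hyz | ⟨h4, h5, h6⟩
    · simp only at hyz
      rw [← hyz]; exact combingEntourage_antitone _ hnN (Or.inr ⟨h1, h2, h3⟩)
    refine Or.inr ⟨hnN'.trans_lt h1, hnN'.trans_lt h5, fun m hm => ?_⟩
    have h7 : ρ < dist (H N z) p := by
      by_contra! hcon
      have := hN₀ N hN₀N z hcon
      linarith
    have h8 : dist (H N x) (H N z) ≤ 2 * (e + 2 * c) := by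
      have := dist_triangle (H N x) (H N y) (H N z)
      have := h3 N le_rfl
      have := h6 N le_rfl
      simp only at *
      linarith
    have h9 := hρ m hm (H N z) (H N x) h7 h8
    have h10 := hc x m N (hm.trans hnN)
    have h11 := hc z m N (hm.trans hnN)
    rw [dist_comm] at h10
    have := dist_triangle4 (H m x) (H m (H N x)) (H m (H N z)) (H m z)
    simp only
    linarith
  · rintro E ⟨r, hr⟩ ε hε
    obtain ⟨n, hn⟩ := hf ε hε
    obtain ⟨ρ, hρ⟩ := he r n
    refine ⟨{x | dist x p ≤ max ρ (n + r)}, (isBounded_iff_exists_dist_le p).2 ⟨_, fun x hx => hx⟩,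
      fun x y hxy hx => hn x y (Or.inr ?_)⟩
    have hxy' := hr _ hxy
    have hr0 : 0 ≤ r := dist_nonneg.trans hxy'
    have hx' : max ρ (n + r) < dist x p := not_le.1 hx
    have h1 := (le_max_left _ _).trans_lt hx'
    have h2 := (le_max_right _ _).trans_lt hx'
    have h3 := dist_triangle x y p
    simp only at hxy' ⊢
    refine ⟨by linarith, by linarith, fun m hm => ?_⟩
    have := hρ m hm x y h1 (by rwa [dist_comm])
    rw [dist_comm] at this
    linarith
  · rw [Metric.tendstoUniformly_iff]
    intro ε hε
    obtain ⟨n, hn⟩ := hf ε hε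
    obtain ⟨N₀, hN₀⟩ := hcomb.exists_dist_le_of_dist_le hc n
    obtain ⟨N₁, hN₁⟩ := hcomb.exists_forall_eq (n + c)
    filter_upwards [eventually_ge_atTop (max n (max N₀ N₁))] with m hm x
    simp only [max_le_iff] at hm
    rw [dist_eq_norm]
    refine hn _ _ ?_
    -- Near `p` the point is already fixed by `H m`. Far from `p`, also `H m x` is outside the
    -- `n`-ball, and coherence bounds the distance of the two paths by `c`.
    by_cases hx : dist x p ≤ n + c
    · exact Or.inl (hN₁ m hm.2.2 x hx).symm
    · refine Or.inr ⟨by simp only; linarith, ?_, fun k hk => ?_⟩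
      · by_contra! hcon
        exact hx (hN₀ m hm.2.1 x hcon)
      · have := hc x k m (hk.trans hm.1)
        rw [dist_comm] at this
        simp only
        linarith

end MetricCombing

/-! ### Smoothed combings -/

/-- `G n x` is a probability measure of finite support near `H n x`. For fixed `n`, the weights are
functions in the combing algebra, and they belong to a finite set of points. -/
structure IsSmoothing {X : Type*} [MetricSpace X] (p : X) (H : ℕ → X → X) (C : ℝ)
    (B : ℕ → Finset X) (G : ℕ → X → X →₀ ℝ) : Prop where
  nonneg : ∀ n x z, 0 ≤ G n x z
  sum_eq_one : ∀ n x, ((G n x).sum fun _ a => a) = 1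
  support_subset : ∀ n x, (G n x).support ⊆ B n
  dist_le : ∀ n x, ∀ z ∈ (G n x).support, dist z (H n x) ≤ C
  vanishingVariation : ∀ n z, VanishingVariation (fun x => ((G n x z : ℝ) : ℂ))
  tendstoUniformly : ∀ n z, TendstoUniformly (fun m x => ((G n (H m x) z : ℝ) : ℂ))
    (fun x => ((G n x z : ℝ) : ℂ)) atTop
  zero : ∀ x, G 0 x = Finsupp.single p 1
  eventually_single : ∀ ρ : ℝ, ∃ N : ℕ, ∀ n ≥ N, ∀ x, dist x p ≤ ρ → G n x = Finsupp.single x 1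

theorem Finsupp.eq_single_one_of_support_subset {α : Type*} {f : α →₀ ℝ} {a : α}
    (h : f.support ⊆ {a}) (h1 : (f.sum fun _ b => b) = 1) : f = Finsupp.single a 1 := by
  have e := Finsupp.support_subset_singleton.1 h
  rw [e, Finsupp.sum_single_index rfl] at h1
  rw [e, h1]

section

variable {X : Type*} [MetricSpace X] [DiscreteTopology X] {p : X} {H : ℕ → X → X}

/-- Comparing times `n` and `0` in the controlledness of `H` confines the range to a ball about `p`,
which is finite because it is compact and discrete. -/
theorem CoarseSpace.IsCombing.finite_range [ProperSpace X] (h : IsCombing p H) (n : ℕ) : (range (H n)).Finite := by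
  obtain ⟨s, -, hs⟩ := h.exists_dist_le 0 n
  refine ((isCompact_closedBall p s).finite_of_discrete).subset ?_
  rintro _ ⟨x, rfl⟩
  have := hs x x n 0 (by simp) (by omega) (by omega)
  rwa [h.zero] at this

theorem exists_isSmoothing [ProperSpace X] (hcomb : IsCombing p H) (hcoh : IsCoherent H)
    (hexp : IsExpanding H) :
    ∃ C B G, 0 ≤ C ∧ IsSmoothing p H C B G := by
  obtain ⟨C, hC0, hcomp, huc⟩ := exists_combingEntourage_constant hcomb hcoh hexp
  have key := fun n => exists_subordinate_partition (combingEntourage p H C)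
    (fun _ _ => Or.inl rfl) (fun _ _ _ => combingEntourage_symm) (combingEntourage_antitone C)
    hcomp (H n) (hcomb.finite_range n) n
  choose G h1 h2 h3 h4 h5 using key
  have huc' : ∀ n z, _ := fun n z => huc (fun x => ((G n x z : ℝ) : ℂ)) fun ε hε => by
    obtain ⟨N, hN⟩ := h5 n ε hε
    refine ⟨N, fun x y hxy => ?_⟩
    rw [← Complex.ofReal_sub, Complex.norm_real]
    exact hN x y hxy z
  refine ⟨C, fun n => (hcomb.finite_range n).toFinset, G, hC0, h1, h2, h3, ?_,
    fun n z => (huc' n z).1, fun n z => (huc' n z).2, ?_, ?_⟩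
  · intro n x z hz
    obtain ⟨y, rfl, hy | ⟨-, -, hy⟩⟩ := h4 n x z hz
    · simp only at hy
      rw [hy, dist_self]; exact hC0
    · rw [dist_comm]; exact hy n le_rfl
  · intro x
    refine Finsupp.eq_single_one_of_support_subset (fun z hz => ?_) (h2 0 x)
    have := h3 0 x hz
    rw [Set.Finite.mem_toFinset] at this
    obtain ⟨y, rfl⟩ := this
    rw [hcomb.zero, Finset.mem_singleton]
  · intro ρ
    obtain ⟨N, hN⟩ := hcomb.exists_forall_eq ρ
    -- For `n ≥ ρ` the entourage of order `n` is diagonal over the `ρ`-ball, so the only possible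
    -- index is `H n x`, which is `x` once `n ≥ N`.
    refine ⟨max N ⌈ρ⌉₊, fun n hn x hx => ?_⟩
    refine Finsupp.eq_single_one_of_support_subset (fun z hz => ?_) (h2 n x)
    rw [Finset.mem_singleton]
    obtain ⟨y, rfl, hy | ⟨hy, -, -⟩⟩ := h4 n x z hz
    · simp only at hy
      rw [← hy]
      exact hN n ((le_max_left _ _).trans hn) x hx
    · have : ρ ≤ n := (Nat.le_ceil _).trans (by exact_mod_cast (le_max_right _ _).trans hn)
      simp only at hy
      linarith

/-- A sufficiently small entourage is diagonal over a ball containing `B`, so the indicator is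
uniformly continuous. -/
theorem exists_mem_combingAlgebra_indicator (hcomb : IsCombing p H) (hcoh : IsCoherent H)
    (hexp : IsExpanding H) (B : Finset X) :
    ∃ f : combingAlgebra H, ∀ x, (f : X →ᵇ ℂ) x = (B : Set X).indicator 1 x := by
  classical
  obtain ⟨C, hC0, hcomp, huc⟩ := exists_combingEntourage_constant hcomb hcoh hexp
  refine ⟨⟨BoundedContinuousFunction.ofNormedAddCommGroup ((B : Set X).indicator 1)
    continuous_of_discreteTopology 1 fun x => ?_, huc _ fun ε hε => ?_⟩, fun x => rfl⟩
  · by_cases hx : x ∈ (B : Set X) <;> simp [hx]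
  · obtain ⟨N, hN⟩ : ∃ N : ℕ, ∀ x ∈ B, dist x p ≤ N := by
      obtain ⟨r, hr⟩ := (B.finite_toSet.image fun x => dist x p).bddAbove
      exact ⟨⌈r⌉₊, fun x hx => (hr ⟨x, hx, rfl⟩).trans (Nat.le_ceil r)⟩
    refine ⟨N, fun x y hxy => ?_⟩
    rcases hxy with hxy | ⟨hx, hy, -⟩
    · simp only at hxy
      simpa [hxy] using hε
    · have hx' : x ∉ (B : Set X) := fun h => (hN x h).not_gt hx
      have hy' : y ∉ (B : Set X) := fun h => (hN y h).not_gt hy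
      simp only [BoundedContinuousFunction.coe_ofNormedAddCommGroup,
        Set.indicator_of_notMem hx', Set.indicator_of_notMem hy']
      simpa using hε

end

/-! ### Affine extension to the Rips complex -/

namespace RipsComplex

variable {X : Type*} [MetricSpace X] {R S : ℝ≥0}

theorem ext_coord {u w : RipsComplex X R} (h : u.coord = w.coord) : u = w := by
  cases u; cases w; simp_all

/-- The extension of a function on `X` to the Rips complex that is affine on simplices. -/
noncomputable def affineExt {E : Type*} [AddCommMonoid E] [Module ℝ E] (g : X → E)
    (w : RipsComplex X R) : E :=
  w.coord.sum fun x a => a • g x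

section

variable {E : Type*} [AddCommMonoid E] [Module ℝ E]

theorem affineExt_vertex (g : X → E) (x : X) : affineExt g (vertex R x) = g x := by
  change ((Finsupp.single x (1 : ℝ)).sum fun x a => a • g x) = g x
  rw [Finsupp.sum_single_index (by simp), one_smul]

theorem affineExt_eq_of_forall {g : X → E} {w : RipsComplex X R} {b : E}
    (h : ∀ x ∈ w.coord.support, g x = b) : affineExt g w = b := by
  unfold affineExt
  rw [Finsupp.sum, Finset.sum_congr rfl fun x hx => by rw [h x hx], ← Finset.sum_smul]
  have := w.sum_eq_one
  rw [Finsupp.sum] at this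
  rw [this, one_smul]

theorem map_affineExt {F : Type*} [AddCommMonoid F] [Module ℝ F] (L : E →ₗ[ℝ] F) (g : X → E)
    (w : RipsComplex X R) : L (affineExt g w) = affineExt (fun x => L (g x)) w := by
  unfold affineExt
  rw [Finsupp.sum, Finsupp.sum, map_sum]
  simp

/-- Where the coordinate of a fixed vertex `v` is non-zero, all supports lie in the finite `R`-ball
about `v`. There the extension is a fixed finite sum of continuous terms. -/
theorem continuous_affineExt [ProperSpace X] [DiscreteTopology X] [TopologicalSpace E]
    [ContinuousAdd E] [ContinuousSMul ℝ E] (g : X → E) :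
    Continuous (affineExt (R := R) g) := by
  rw [continuous_iff_continuousAt]
  intro w
  obtain ⟨v, hv⟩ := w.support_nonempty
  have hfin : (Metric.closedBall v (R : ℝ)).Finite :=
    (isCompact_closedBall v (R : ℝ)).finite_of_discrete
  have hc : ∀ v, Continuous fun w : RipsComplex X R => w.coord v := fun v =>
    (continuous_apply v).comp continuous_induced_dom
  have h1 : ContinuousAt (fun w : RipsComplex X R => ∑ x ∈ hfin.toFinset, w.coord x • g x) w :=
    (continuous_finsetSum _ fun x _ => (hc x).smul continuous_const).continuousAt
  refine h1.congr ?_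
  filter_upwards [(isOpen_ne.preimage (hc v)).mem_nhds (Finsupp.mem_support_iff.1 hv)] with w' hw'
  unfold affineExt
  rw [Finsupp.sum]
  refine (Finset.sum_subset (fun x hx => ?_) fun x _ hx => ?_).symm
  · rw [Set.Finite.mem_toFinset, Metric.mem_closedBall]
    exact w'.dist_le x hx v (Finsupp.mem_support_iff.2 hw')
  · rw [Finsupp.notMem_support_iff.1 hx, zero_smul]

end

theorem norm_affineExt_sub_le {E : Type*} [SeminormedAddCommGroup E] [NormedSpace ℝ E] {g : X → E}
    {w : RipsComplex X R} {b : E} {ε : ℝ} (h : ∀ x ∈ w.coord.support, ‖g x - b‖ ≤ ε) :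
    ‖affineExt g w - b‖ ≤ ε := by
  have h1 := w.sum_eq_one
  rw [Finsupp.sum] at h1
  have e : affineExt g w - b = ∑ x ∈ w.coord.support, w.coord x • (g x - b) := by
    simp_rw [smul_sub]
    rw [Finset.sum_sub_distrib, ← Finset.sum_smul, h1, one_smul]
    rfl
  rw [e]
  calc _ ≤ ∑ x ∈ w.coord.support, w.coord x * ε := by
        refine norm_sum_le_of_le _ fun x hx => ?_
        rw [norm_smul, Real.norm_of_nonneg (w.nonneg x)]
        exact mul_le_mul_of_nonneg_left (h x hx) (w.nonneg x)
    _ = ε := by rw [← Finset.sum_mul, h1, one_mul]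

theorem norm_affineExt_sub_affineExt_le {E : Type*} [SeminormedAddCommGroup E] [NormedSpace ℝ E]
    {g g' : X → E} {w : RipsComplex X R} {ε : ℝ} (h : ∀ x, ‖g x - g' x‖ ≤ ε) :
    ‖affineExt g w - affineExt g' w‖ ≤ ε := by
  have e : affineExt g w - affineExt g' w = affineExt (fun x => g x - g' x) w - 0 := by
    unfold affineExt Finsupp.sum
    simp_rw [smul_sub]
    rw [Finset.sum_sub_distrib, sub_zero]
  rw [e]
  exact norm_affineExt_sub_le fun x _ => by rw [sub_zero]; exact h x

/-! ### The combing algebra of the Rips complex -/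

theorem isBounded_of_carrier (p : X) {K : Set (RipsComplex X R)} {ρ : ℝ}
    (h : ∀ w ∈ K, dist w.carrier p ≤ ρ) : CoarseSpace.IsBounded K := by
  refine ⟨(R + ρ) + (R + ρ), ?_⟩
  have key : ∀ w ∈ K, ∀ v ∈ w.coord.support, dist v p ≤ R + ρ := fun w hw v hv =>
    (dist_triangle v w.carrier p).trans (add_le_add (w.dist_le v hv _ w.carrier_mem) (h w hw))
  rintro ⟨u, w⟩ ⟨hu, hw⟩ v hv v' hv'
  exact (dist_triangle_right v v' p).trans (add_le_add (key u hu v hv) (key w hw v' hv'))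

theorem exists_dist_le_of_isBounded (p : X) {K : Set (RipsComplex X R)}
    (h : CoarseSpace.IsBounded K) : ∃ ρ : ℝ, ∀ w ∈ K, ∀ v ∈ w.coord.support, dist v p ≤ ρ := by
  obtain ⟨r, hr⟩ := h
  rcases K.eq_empty_or_nonempty with rfl | ⟨a, ha⟩
  · exact ⟨0, by simp⟩
  · exact ⟨r + dist a.carrier p, fun w hw v hv => (dist_triangle v a.carrier p).trans
      (by gcongr; exact hr (w, a) ⟨hw, ha⟩ v hv _ a.carrier_mem)⟩

theorem vanishingVariation_iff (p : X) {f : RipsComplex X R → ℂ} :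
    VanishingVariation f ↔ ∀ r : ℝ, ∀ ε > 0, ∃ ρ : ℝ, ∀ u w : RipsComplex X R,
      (∀ v ∈ u.coord.support, ∀ v' ∈ w.coord.support, dist v v' ≤ r) → ρ < dist u.carrier p →
      ‖f u - f w‖ < ε := by
  constructor
  · intro h r ε hε
    obtain ⟨K, hK, hK'⟩ := h {q | ∀ v ∈ q.1.coord.support, ∀ v' ∈ q.2.coord.support, dist v v' ≤ r}
      ⟨r, fun q hq => hq⟩ ε hε
    obtain ⟨ρ, hρ⟩ := exists_dist_le_of_isBounded p hK
    exact ⟨ρ, fun u w huw hu => hK' u w huw fun huK => (hρ u huK _ u.carrier_mem).not_gt hu⟩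
  · rintro h E ⟨r, hr⟩ ε hε
    obtain ⟨ρ, hρ⟩ := h r ε hε
    exact ⟨{w | dist w.carrier p ≤ ρ}, isBounded_of_carrier p fun w hw => hw,
      fun u w huw hu => hρ u w (hr _ huw) (not_le.1 hu)⟩

theorem vanishesAtInfinity_iff (p : X) {f : RipsComplex X R → ℂ} :
    VanishesAtInfinity f ↔ ∀ ε > 0, ∃ ρ : ℝ, ∀ w : RipsComplex X R, ρ < dist w.carrier p →
      ‖f w‖ < ε := by
  constructor
  · intro h ε hε
    obtain ⟨K, hK, hK'⟩ := h ε hε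
    obtain ⟨ρ, hρ⟩ := exists_dist_le_of_isBounded p hK
    exact ⟨ρ, fun w hw => hK' w fun hwK => (hρ w hwK _ w.carrier_mem).not_gt hw⟩
  · intro h ε hε
    obtain ⟨ρ, hρ⟩ := h ε hε
    exact ⟨{w | dist w.carrier p ≤ ρ}, isBounded_of_carrier p fun w hw => hw,
      fun w hw => hρ w (not_le.1 hw)⟩

/-- Far out, `g` is nearly constant on the vertices in question, and the extension is a convex
combination of its values there. -/
theorem exists_norm_affineExt_sub_lt {g : X → ℂ} (hg : VanishingVariation g) (p : X) (r : ℝ)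
    {ε : ℝ} (hε : 0 < ε) : ∃ ρ : ℝ, ∀ (x : X) (w : RipsComplex X R), ρ < dist x p →
      (∀ v ∈ w.coord.support, dist x v ≤ r) → ‖affineExt g w - g x‖ < ε := by
  obtain ⟨K, hK, hK'⟩ := hg {q | dist q.1 q.2 ≤ r} ⟨r, fun q hq => hq⟩ (ε / 2) (by positivity)
  obtain ⟨ρ, hρ⟩ := (CoarseSpace.isBounded_iff_exists_dist_le p).1 hK
  refine ⟨ρ, fun x w hx hw => lt_of_le_of_lt (norm_affineExt_sub_le (ε := ε / 2) fun v hv => ?_)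
    (by linarith)⟩
  rw [norm_sub_rev]
  exact (hK' x v (hw v hv) fun h => (hρ x h).not_gt hx).le

theorem vanishingVariation_affineExt {g : X → ℂ} (hg : VanishingVariation g) :
    VanishingVariation (affineExt (R := R) g) := by
  rcases isEmpty_or_nonempty X with hX | ⟨⟨p⟩⟩
  · intro E hE ε hε
    exact ⟨∅, CoarseSpace.subset CoarseSpace.diag (by simp), fun u => (hX.false u.carrier).elim⟩
  rw [vanishingVariation_iff p]
  intro r ε hε
  obtain ⟨ρ, hρ⟩ := exists_norm_affineExt_sub_lt (R := R) hg p r (half_pos hε)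
  obtain ⟨ρ', hρ'⟩ := exists_norm_affineExt_sub_lt (R := R) hg p R (half_pos hε)
  refine ⟨max ρ ρ', fun u w huw hu => ?_⟩
  have h1 := hρ u.carrier w ((le_max_left _ _).trans_lt hu) (huw _ u.carrier_mem)
  have h2 := hρ' u.carrier u ((le_max_right _ _).trans_lt hu) (u.dist_le _ u.carrier_mem)
  rw [← sub_sub_sub_cancel_right _ _ (g u.carrier)]
  exact (norm_sub_le _ _).trans_lt (by linarith)

theorem tendstoUniformly_affineExt {p : X} {H : ℕ → X → X} (hcomb : IsCombing p H) {g : X → ℂ}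
    (hg : VanishingVariation g) (hg' : TendstoUniformly (fun n x => g (H n x)) g atTop) :
    TendstoUniformly (fun n w => affineExt g (combing (R := R) H n w)) (affineExt g) atTop := by
  rw [Metric.tendstoUniformly_iff] at hg' ⊢
  intro ε hε
  obtain ⟨ρ, hρ⟩ := exists_norm_affineExt_sub_lt (R := R) hg p R (half_pos hε)
  obtain ⟨N, hN⟩ := hcomb.exists_forall_eq ρ
  -- The `+ 1` ensures `n ≠ 0`, without which `combing` does not fix `w`.
  filter_upwards [hg' _ (half_pos hε), eventually_ge_atTop (N + 1)] with n h1 h2 w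
  unfold combing
  split_ifs with h
  · rwa [dist_self]
  · rw [affineExt_vertex]
    by_cases hw : dist w.carrier p ≤ ρ
    · exact (h ⟨by omega, hN n (by omega) _ hw⟩).elim
    · have h3 := hρ w.carrier w (not_le.1 hw) (w.dist_le _ w.carrier_mem)
      have h4 := h1 w.carrier
      rw [← dist_eq_norm] at h3
      exact (dist_triangle _ _ _).trans_lt (by linarith)

end RipsComplex

/-! ### The combing compactification -/

section

variable {Y Z : Type*} [TopologicalSpace Y] [CoarseSpace Y] [TopologicalSpace Z] [CoarseSpace Z]

/-- The C⋆-algebra structure of the combing algebra. -/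
@[reducible]
noncomputable def combingAlgebra.commCStarAlgebra (H : ℕ → Y → Y) :
    CommCStarAlgebra (combingAlgebra H) := CommCStarAlgebra.mk

namespace CombingCompactification

variable {H : ℕ → Y → Y}

theorem point_apply (y : Y) (f : combingAlgebra H) : point H y f = (f : Y →ᵇ ℂ) y := rfl

theorem continuous_iff {W : Type*} [TopologicalSpace W] {F : W → CombingCompactification H} :
    Continuous F ↔ ∀ f : combingAlgebra H, Continuous fun w => F w f := by
  refine ⟨fun h f => ?_, fun h => ?_⟩
  · exact (WeakDual.gelfandTransform ℂ (combingAlgebra H) f).continuous.comp h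
  · exact continuous_induced_rng.2 (WeakDual.continuous_of_continuous_eval h)

theorem continuous_apply (f : combingAlgebra H) :
    Continuous fun φ : CombingCompactification H => φ f :=
  continuous_iff.1 continuous_id f

theorem continuous_point : Continuous (point H) :=
  continuous_iff.2 fun f => (f : Y →ᵇ ℂ).continuous

/-- The Gelfand transform is isometric into the continuous functions on a compact space, where
evaluation is jointly continuous. -/
theorem continuous_eval :
    Continuous fun q : combingAlgebra H × CombingCompactification H => q.2 q.1 := by
  have h : Continuous (WeakDual.gelfandTransform ℂ (combingAlgebra H)) :=
    (@gelfandTransform_isometry _ (combingAlgebra.commCStarAlgebra H)).continuous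
  exact (h.comp continuous_fst).eval continuous_snd

/-- A Urysohn function vanishing on the closure but not at some `φ` would be a Gelfand transform, by
Gelfand duality, of a function that is zero on all of `Y`. -/
theorem denseRange_point : DenseRange (point H) := by
  rw [denseRange_iff_closure_range]
  by_contra hne
  obtain ⟨φ, hφ⟩ := (ne_univ_iff_exists_notMem _).1 hne
  obtain ⟨F, hF0, hF1, -⟩ := exists_continuous_zero_one_of_isClosed
    (isClosed_closure (s := range (point H))) (isClosed_singleton (x := φ))
    (disjoint_singleton_right.2 hφ)
  let F' : C(CombingCompactification H, ℂ) := ⟨fun φ => (F φ : ℂ), by fun_prop⟩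
  obtain ⟨f, hf⟩ := (@gelfandTransform_bijective _ (combingAlgebra.commCStarAlgebra H)).2 F'
  have hf' : ∀ ψ : CombingCompactification H, ψ f = F ψ := fun ψ => DFunLike.congr_fun hf ψ
  have h0 : f = 0 := by
    ext y
    have := hf' (point H y)
    rw [hF0 (subset_closure ⟨y, rfl⟩)] at this
    simpa [point_apply] using this
  have := hf' φ
  rw [h0, hF1 rfl] at this
  simp at this

/-- A character that does not vanish on `C_0(Y)` is the evaluation at a point, provided that bounded
sets are contained in compact sets. -/
theorem mem_range_point_of_notMem_combingCorona
    (hY : ∀ K : Set Y, CoarseSpace.IsBounded K → ∃ L, IsCompact L ∧ K ⊆ L)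
    {φ : CombingCompactification H} (h : φ ∉ combingCorona H) : φ ∈ range (point H) := by
  simp only [combingCorona, Set.mem_ofPred_eq, not_forall] at h
  obtain ⟨f, hf, hφ⟩ := h
  have hpos : 0 < ‖φ f‖ := norm_pos_iff.2 hφ
  obtain ⟨K, hK, hK'⟩ := hf (‖φ f‖ / 2) (half_pos hpos)
  obtain ⟨L, hL, hKL⟩ := hY K hK
  have hcl : IsClosed (point H '' L) := (hL.image continuous_point).isClosed
  have hO : IsOpen {ψ : CombingCompactification H | ‖φ f‖ / 2 < ‖ψ f‖} :=
    isOpen_lt continuous_const (continuous_apply f).norm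
  have h1 : φ ∈ closure ({ψ : CombingCompactification H | ‖φ f‖ / 2 < ‖ψ f‖} ∩ range (point H)) :=
    denseRange_point.open_subset_closure_inter hO (half_lt_self hpos)
  have h2 : {ψ : CombingCompactification H | ‖φ f‖ / 2 < ‖ψ f‖} ∩ range (point H) ⊆
      point H '' L := by
    rintro _ ⟨hy, y, rfl⟩
    refine ⟨y, hKL ?_, rfl⟩
    by_contra hyK
    exact lt_asymm (hK' y hyK) hy
  exact image_subset_range _ _ (hcl.closure_subset_iff.2 h2 h1)

theorem isClosed_combingCorona : IsClosed (combingCorona H) := by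
  have : combingCorona H = ⋂ (f : combingAlgebra H) (_ : VanishesAtInfinity (f : Y →ᵇ ℂ)),
      {φ | φ f = 0} := by
    ext φ; simp [combingCorona]
  rw [this]
  exact isClosed_iInter fun f => isClosed_iInter fun _ =>
    isClosed_eq (continuous_apply f) continuous_const

end CombingCompactification

theorem IsCombedMap.map_apply {H : ℕ → Y → Y} {G : ℕ → Z → Z} {α : Y → Z} (h : IsCombedMap H G α)
    (φ : CombingCompactification H) (f : combingAlgebra G) : h.map φ f = φ (h.pullback f) := rfl

/-- A family of maps that induces a homotopy of maps between combing compactifications. -/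
structure IsCombedHomotopy (H : ℕ → Y → Y) (G : ℕ → Z → Z) (h : I → Y → Z) : Prop where
  continuous : ∀ t, Continuous (h t)
  vanishingVariation : ∀ t, ∀ f ∈ combingAlgebra G, VanishingVariation fun y => f (h t y)
  tendstoUniformly : ∀ t, ∀ f ∈ combingAlgebra G,
    TendstoUniformly (fun n y => f (h t (H n y))) (fun y => f (h t y)) atTop
  eventually_le : ∀ f ∈ combingAlgebra G, ∀ t₀, ∀ ε > 0, ∀ᶠ t in 𝓝 t₀, ∀ y,
    ‖f (h t y) - f (h t₀ y)‖ ≤ ε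

namespace IsCombedHomotopy

variable {H : ℕ → Y → Y} {G : ℕ → Z → Z} {h : I → Y → Z}

/-- Composition with `h t`, as a map `C_G(Z) → C_H(Y)`. -/
noncomputable def pullback (hh : IsCombedHomotopy H G h) (t : I) :
    combingAlgebra G →⋆ₐ[ℂ] combingAlgebra H where
  toFun f := ⟨(f : Z →ᵇ ℂ).compContinuous ⟨h t, hh.continuous t⟩,
    hh.vanishingVariation t f f.2, hh.tendstoUniformly t f f.2⟩
  map_one' := rfl
  map_mul' _ _ := rfl
  map_zero' := rfl
  map_add' _ _ := rfl
  commutes' _ := rfl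
  map_star' _ := rfl

theorem pullback_apply (hh : IsCombedHomotopy H G h) (t : I) (f : combingAlgebra G) (y : Y) :
    (hh.pullback t f : Y →ᵇ ℂ) y = (f : Z →ᵇ ℂ) (h t y) := rfl

theorem continuous_pullback (hh : IsCombedHomotopy H G h) (f : combingAlgebra G) :
    Continuous fun t => hh.pullback t f := by
  rw [continuous_iff_continuousAt]
  intro t₀
  rw [ContinuousAt, Metric.tendsto_nhds]
  intro ε hε
  filter_upwards [hh.eventually_le f f.2 t₀ (ε / 2) (half_pos hε)] with t ht
  refine lt_of_le_of_lt ?_ (half_lt_self hε)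
  rw [Subtype.dist_eq, BoundedContinuousFunction.dist_le (half_pos hε).le]
  intro y
  rw [dist_eq_norm]
  exact ht y

/-- The homotopy of maps between combing compactifications induced by `h`. -/
noncomputable def map (hh : IsCombedHomotopy H G h) :
    C(I × CombingCompactification H, CombingCompactification G) where
  toFun q := WeakDual.CharacterSpace.compContinuousMap (hh.pullback q.1) q.2
  continuous_toFun := CombingCompactification.continuous_iff.2 fun f =>
    CombingCompactification.continuous_eval.comp
      (((hh.continuous_pullback f).comp continuous_fst).prodMk continuous_snd)

theorem map_apply (hh : IsCombedHomotopy H G h) (t : I) (φ : CombingCompactification H)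
    (f : combingAlgebra G) : hh.map (t, φ) f = φ (hh.pullback t f) := rfl

end IsCombedHomotopy

end

/-! ### Characters of the combing algebra of a Rips complex -/

namespace RipsComplex

variable {X : Type*} [MetricSpace X] {R S : ℝ≥0}

theorem continuous_coord (x : X) : Continuous fun w : RipsComplex X R => w.coord x :=
  (continuous_apply x).comp continuous_induced_dom

theorem coord_le_one (w : RipsComplex X R) (x : X) : w.coord x ≤ 1 := by
  rw [← w.sum_eq_one]
  by_cases hx : x ∈ w.coord.support
  · exact Finset.single_le_sum (f := w.coord) (fun y _ => w.nonneg y) hx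
  · rw [Finsupp.notMem_support_iff.1 hx]
    exact Finset.sum_nonneg fun y _ => w.nonneg y

theorem sum_coord_eq_one {w : RipsComplex X R} {B : Finset X} (h : w.coord.support ⊆ B) :
    ∑ x ∈ B, w.coord x = 1 := by
  rw [← w.sum_eq_one]
  exact (Finsupp.sum_of_support_subset w.coord h (fun _ a => a) fun _ _ => rfl).symm

theorem isCompact_setOf_support_subset (B : Finset X) :
    IsCompact {w : RipsComplex X R | w.coord.support ⊆ B} := by
  classical
  have hind : IsInducing fun (w : RipsComplex X R) x => w.coord x := ⟨rfl⟩
  rw [hind.isCompact_iff]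
  -- The condition on the diameter of the support becomes closed in this form: coordinates of points
  -- more than `R` apart have product zero.
  have e : (fun (w : RipsComplex X R) x => w.coord x) '' {w | w.coord.support ⊆ B} =
      (Set.univ.pi fun _ => Icc (0 : ℝ) 1) ∩ ({a | ∀ x ∉ B, a x = 0} ∩
        ({a | ∑ x ∈ B, a x = 1} ∩ {a | ∀ x y, (R : ℝ) < dist x y → a x * a y = 0})) := by
    ext a
    constructor
    · rintro ⟨w, hw, rfl⟩
      refine ⟨fun x _ => ⟨w.nonneg x, w.coord_le_one x⟩, fun x hx => ?_, sum_coord_eq_one hw,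
        fun x y hxy => ?_⟩
      · exact Finsupp.notMem_support_iff.1 fun h => hx (hw h)
      · by_contra hne
        rw [mul_eq_zero, not_or] at hne
        exact (w.dist_le x (Finsupp.mem_support_iff.2 hne.1) y
          (Finsupp.mem_support_iff.2 hne.2)).not_gt hxy
    · rintro ⟨h1, h2, h3, h4⟩
      have hB : ∀ x, a x ≠ 0 → x ∈ B := fun x hx => by_contra fun hxB => hx (h2 x hxB)
      refine ⟨⟨Finsupp.onFinset B a hB, fun x => (h1 x trivial).1, ?_, ?_⟩, ?_, rfl⟩
      · rw [Finsupp.onFinset_sum _ fun _ => rfl]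
        exact h3
      · intro x hx y hy
        by_contra! hxy
        rw [Finsupp.mem_support_iff, Finsupp.onFinset_apply] at hx hy
        exact mul_ne_zero hx hy (h4 x y hxy)
      · exact Finsupp.support_onFinset_subset (hf := hB)
  rw [e]
  refine (isCompact_univ_pi fun _ => isCompact_Icc).inter_right (IsClosed.inter ?_ (IsClosed.inter
    ?_ ?_))
  · simp only [Set.ofPred_forall]
    exact isClosed_iInter fun x => isClosed_iInter fun _ =>
      isClosed_eq (continuous_apply x) continuous_const
  · exact isClosed_eq (continuous_finsetSum _ fun x _ => continuous_apply x) continuous_const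
  · simp only [Set.ofPred_forall]
    exact isClosed_iInter fun x => isClosed_iInter fun y => isClosed_iInter fun _ =>
      isClosed_eq ((continuous_apply x).mul (continuous_apply y)) continuous_const

theorem exists_isCompact_of_isBounded [ProperSpace X] [DiscreteTopology X]
    {K : Set (RipsComplex X R)} (hK : CoarseSpace.IsBounded K) : ∃ L, IsCompact L ∧ K ⊆ L := by
  rcases K.eq_empty_or_nonempty with rfl | ⟨a, ha⟩
  · exact ⟨∅, isCompact_empty, Subset.rfl⟩
  obtain ⟨ρ, hρ⟩ := exists_dist_le_of_isBounded a.carrier hK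
  refine ⟨_, isCompact_setOf_support_subset
    (isCompact_closedBall a.carrier ρ).finite_of_discrete.toFinset, fun w hw v hv => ?_⟩
  rw [Set.Finite.mem_toFinset]
  exact hρ w hw v hv

/-- A continuous function is uniformly continuous on a finite union of simplices. -/
theorem exists_forall_norm_sub_lt {f : RipsComplex X R → ℂ} (hf : Continuous f) (B : Finset X)
    {ε : ℝ} (hε : 0 < ε) : ∃ δ > 0, ∀ u w : RipsComplex X R, u.coord.support ⊆ B →
      w.coord.support ⊆ B → (∀ z ∈ B, |u.coord z - w.coord z| < δ) → ‖f u - f w‖ < ε := by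
  let Q : Set (RipsComplex X R) := {w | w.coord.support ⊆ B}
  let D : RipsComplex X R × RipsComplex X R → ℝ := fun q => ∑ z ∈ B, |q.1.coord z - q.2.coord z|
  have hD : Continuous D := continuous_finsetSum _ fun z _ =>
    (((continuous_coord z).comp continuous_fst).sub ((continuous_coord z).comp continuous_snd)).abs
  have hcl : IsClosed {q : RipsComplex X R × RipsComplex X R | ε ≤ ‖f q.1 - f q.2‖} :=
    isClosed_le continuous_const ((hf.comp continuous_fst).sub (hf.comp continuous_snd)).norm
  have hQ : IsCompact ((Q ×ˢ Q) ∩ {q | ε ≤ ‖f q.1 - f q.2‖}) :=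
    ((isCompact_setOf_support_subset B).prod (isCompact_setOf_support_subset B)).inter_right hcl
  -- On the compact set of pairs with values at least `ε` apart, the coordinate distance `D` never
  -- vanishes, so it has a positive lower bound.
  obtain ⟨δ, hδ, hδ'⟩ := hQ.exists_forall_le' hD.continuousOn (a := 0) (by
    rintro ⟨u, w⟩ ⟨⟨hu, hw⟩, huw⟩
    refine lt_of_le_of_ne (Finset.sum_nonneg fun z _ => abs_nonneg _) fun h0 => ?_
    have h1 := (Finset.sum_eq_zero_iff_of_nonneg fun z _ => abs_nonneg _).1 h0.symm
    have h2 : u = w := by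
      refine ext_coord (Finsupp.ext fun z => ?_)
      by_cases hz : z ∈ B
      · exact sub_eq_zero.1 (abs_eq_zero.1 (h1 z hz))
      · rw [Finsupp.notMem_support_iff.1 fun h => hz (hu h),
          Finsupp.notMem_support_iff.1 fun h => hz (hw h)]
    rw [Set.mem_ofPred_eq, h2, sub_self, norm_zero] at huw
    exact huw.not_gt hε)
  refine ⟨δ / (B.card + 1), by positivity, fun u w hu hw huw => ?_⟩
  by_contra! hcon
  have h1 := hδ' (u, w) ⟨⟨hu, hw⟩, hcon⟩
  have h2 : D (u, w) ≤ B.card * (δ / (B.card + 1)) := by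
    rw [← nsmul_eq_mul]
    exact Finset.sum_le_card_nsmul _ _ _ fun z hz => (huw z hz).le
  have h3 : δ / ((B.card : ℝ) + 1) * (B.card + 1) = δ := by field_simp
  have h4 : 0 < δ / ((B.card : ℝ) + 1) := by positivity
  nlinarith

end RipsComplex

namespace RipsComplex

variable {X : Type*} [MetricSpace X] [DiscreteTopology X] {R S : ℝ≥0} {p : X} {H : ℕ → X → X}

theorem map_vertex_mem_combingCorona {φ : CombingCompactification H} (hφ : φ ∈ combingCorona H) :
    (isCombedMap_vertex H R).map φ ∈ combingCorona (combing (R := R) H) := by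
  intro f hf
  refine hφ _ fun ε hε => ?_
  obtain ⟨K, hK, hK'⟩ := hf ε hε
  exact ⟨_, (isCombedMap_vertex H R).proper K hK, fun x hx => hK' _ hx⟩

variable [ProperSpace X]

/-- The affine extension of a function in the combing algebra. -/
noncomputable def extend (hcomb : IsCombing p H) (R : ℝ≥0) (g : combingAlgebra H) :
    combingAlgebra (combing (R := R) H) :=
  ⟨BoundedContinuousFunction.ofNormedAddCommGroup (affineExt (g : X →ᵇ ℂ))
    (continuous_affineExt _) ‖(g : X →ᵇ ℂ)‖ fun w => by
      rw [← sub_zero (affineExt _ w)]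
      exact norm_affineExt_sub_le fun x _ => by
        rw [sub_zero]; exact (g : X →ᵇ ℂ).norm_coe_le_norm x,
    vanishingVariation_affineExt g.2.1, tendstoUniformly_affineExt hcomb g.2.1 g.2.2⟩

theorem extend_apply (hcomb : IsCombing p H) (g : combingAlgebra H) (w : RipsComplex X R) :
    (extend hcomb R g : RipsComplex X R →ᵇ ℂ) w = affineExt (g : X →ᵇ ℂ) w := rfl

theorem pullback_extend (hcomb : IsCombing p H) (g : combingAlgebra H) :
    (isCombedMap_vertex H R).pullback (extend hcomb R g) = g := by
  ext x
  exact affineExt_vertex _ x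

theorem vanishesAtInfinity_extend (hcomb : IsCombing p H) {g : combingAlgebra H}
    (hg : VanishesAtInfinity (g : X →ᵇ ℂ)) :
    VanishesAtInfinity (extend hcomb R g : RipsComplex X R →ᵇ ℂ) := by
  rw [vanishesAtInfinity_iff p]
  intro ε hε
  obtain ⟨K, hK, hK'⟩ := hg (ε / 2) (half_pos hε)
  obtain ⟨ρ, hρ⟩ := (isBounded_iff_exists_dist_le p).1 hK
  refine ⟨R + ρ, fun w hw => lt_of_le_of_lt ?_ (half_lt_self hε)⟩
  rw [extend_apply, ← sub_zero (affineExt _ w)]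
  refine norm_affineExt_sub_le fun x hx => ?_
  rw [sub_zero]
  refine (hK' x fun hxK => ?_).le
  have h1 := dist_triangle w.carrier x p
  have h2 := w.dist_le _ w.carrier_mem x hx
  have h3 := hρ x hxK
  linarith

/-- Far out, both functions are close to the value of `f` at the vertex `w.carrier`. This is what
identifies the corona of `P_R(X)` with that of `X`. -/
theorem vanishesAtInfinity_sub_extend (hcomb : IsCombing p H)
    (f : combingAlgebra (combing (R := R) H)) : VanishesAtInfinity
      ((f - extend hcomb R ((isCombedMap_vertex H R).pullback f) : combingAlgebra _) :
        RipsComplex X R →ᵇ ℂ) := by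
  rw [vanishesAtInfinity_iff p]
  intro ε hε
  obtain ⟨ρ, hρ⟩ := (vanishingVariation_iff p).1 f.2.1 R (ε / 2) (half_pos hε)
  obtain ⟨ρ', hρ'⟩ := exists_norm_affineExt_sub_lt (R := R)
    ((isCombedMap_vertex H R).pullback f).2.1 p R (half_pos hε)
  refine ⟨max ρ ρ', fun w hw => ?_⟩
  have h1 := hρ w (vertex R w.carrier) (fun v hv v' hv' => by
    rw [support_vertex, Finset.mem_singleton] at hv'
    rw [hv']
    exact w.dist_le v hv _ w.carrier_mem) ((le_max_left _ _).trans_lt hw)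
  have h2 := hρ' w.carrier w ((le_max_right _ _).trans_lt hw) (w.dist_le _ w.carrier_mem)
  have e : ((f - extend hcomb R ((isCombedMap_vertex H R).pullback f) : combingAlgebra _) :
        RipsComplex X R →ᵇ ℂ) w = ((f : RipsComplex X R →ᵇ ℂ) w -
      (f : RipsComplex X R →ᵇ ℂ) (vertex R w.carrier)) -
      (affineExt ((isCombedMap_vertex H R).pullback f : X →ᵇ ℂ) w -
        ((isCombedMap_vertex H R).pullback f : X →ᵇ ℂ) w.carrier) := by
    have e1 : ((isCombedMap_vertex H R).pullback f : X →ᵇ ℂ) w.carrier =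
      (f : RipsComplex X R →ᵇ ℂ) (vertex R w.carrier) := rfl
    rw [e1, sub_sub_sub_cancel_right]
    rfl
  rw [e]
  exact (norm_sub_le _ _).trans_lt (by linarith)

theorem apply_eq_apply_extend (hcomb : IsCombing p H) {φ : RipsCompactification H R}
    (hφ : φ ∈ combingCorona (combing (R := R) H)) (f : combingAlgebra (combing (R := R) H)) :
    φ f = φ (extend hcomb R ((isCombedMap_vertex H R).pullback f)) := by
  have := hφ _ (vanishesAtInfinity_sub_extend hcomb f)
  rwa [map_sub, sub_eq_zero] at this

/-- Every character that vanishes on `C_0` comes from the corona of `X`. -/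
theorem exists_map_vertex_eq (hcomb : IsCombing p H) {φ : RipsCompactification H R}
    (hφ : φ ∈ combingCorona (combing (R := R) H)) :
    ∃ ψ ∈ combingCorona H, (isCombedMap_vertex H R).map ψ = φ := by
  have key := apply_eq_apply_extend hcomb hφ
  -- Affine extension is multiplicative only modulo `C_0`; since `φ` kills `C_0`, the composite is
  -- still a character.
  let ψ : CombingCompactification H := WeakDual.CharacterSpace.equivAlgHom.symm
    { toFun := fun g => φ (extend hcomb R g)
      map_one' := by
        rw [← map_one (isCombedMap_vertex H R).pullback, ← key, map_one]
      map_mul' := fun g g' => by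
        rw [← map_mul, key (_ * _), map_mul, pullback_extend, pullback_extend]
      map_zero' := by
        rw [← map_zero (isCombedMap_vertex H R).pullback, ← key, map_zero]
      map_add' := fun g g' => by
        rw [← map_add, key (_ + _), map_add, pullback_extend, pullback_extend]
      commutes' := fun c => by
        rw [← AlgHomClass.commutes (isCombedMap_vertex H R).pullback, ← key, AlgHomClass.commutes] }
  have hψ : ∀ g, ψ g = φ (extend hcomb R g) := fun g => rfl
  refine ⟨ψ, fun g hg => ?_, ?_⟩
  · rw [hψ]
    exact hφ _ (vanishesAtInfinity_extend hcomb hg)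
  · refine WeakDual.CharacterSpace.ext fun f => ?_
    rw [IsCombedMap.map_apply, hψ, ← key]

/-- Affine extension is a section of restriction to `X`, so the latter is surjective on algebras. -/
theorem map_vertex_injective (hcomb : IsCombing p H) :
    Function.Injective (isCombedMap_vertex H R).map := by
  intro φ ψ h
  refine WeakDual.CharacterSpace.ext fun g => ?_
  have := congrArg (fun χ : RipsCompactification H R => χ (extend hcomb R g)) h
  simp only [IsCombedMap.map_apply, pullback_extend] at this
  exact this

/-- The affine extension of the indicator of `B` does this. It is the test function that separates
points from the corona and, for singletons `B`, points from one another. -/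
theorem exists_eq_sum_coord (hcomb : IsCombing p H) (hcoh : IsCoherent H) (hexp : IsExpanding H)
    (R : ℝ≥0) (B : Finset X) : ∃ b : combingAlgebra (combing (R := R) H),
      VanishesAtInfinity (b : RipsComplex X R →ᵇ ℂ) ∧
      ∀ w, (b : RipsComplex X R →ᵇ ℂ) w = ((∑ x ∈ B, w.coord x : ℝ) : ℂ) := by
  classical
  obtain ⟨f, hf⟩ := exists_mem_combingAlgebra_indicator hcomb hcoh hexp B
  refine ⟨extend hcomb R f, vanishesAtInfinity_extend hcomb fun ε hε => ⟨(B : Set X), ?_, ?_⟩, ?_⟩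
  · obtain ⟨r, hr⟩ := (B.finite_toSet.image fun x => dist x p).bddAbove
    exact (isBounded_iff_exists_dist_le p).2 ⟨r, fun x hx => hr ⟨x, hx, rfl⟩⟩
  · intro x hx
    rw [hf, Set.indicator_of_notMem hx, norm_zero]
    exact hε
  · intro w
    rw [extend_apply]
    unfold affineExt
    rw [Finsupp.sum_of_support_subset w.coord (Finset.subset_union_left (s₂ := B)) _ (by simp),
      Complex.ofReal_sum]
    refine (Finset.sum_subset_zero_on_sdiff Finset.subset_union_right (fun x hx => ?_)
      fun x hx => ?_).symm
    · rw [hf, Set.indicator_of_notMem (by simpa using (Finset.mem_sdiff.1 hx).2), smul_zero]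
    · rw [hf, Set.indicator_of_mem (by simpa using hx)]
      simp

theorem point_notMem_combingCorona (hcomb : IsCombing p H) (hcoh : IsCoherent H)
    (hexp : IsExpanding H) (w : RipsComplex X R) :
    CombingCompactification.point _ w ∉ combingCorona (combing (R := R) H) := by
  intro h
  obtain ⟨b, hb, hb'⟩ := exists_eq_sum_coord hcomb hcoh hexp R w.coord.support
  have := h b hb
  rw [CombingCompactification.point_apply, hb', sum_coord_eq_one Finset.Subset.rfl] at this
  simp at this

theorem eq_point_of_notMem_combingCorona {φ : RipsCompactification H R}
    (h : φ ∉ combingCorona (combing (R := R) H)) :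
    ∃ w, CombingCompactification.point _ w = φ :=
  CombingCompactification.mem_range_point_of_notMem_combingCorona
    (fun _ => exists_isCompact_of_isBounded) h

end RipsComplex

-- Inclusions between compactified Rips complexes

namespace RipsCompactification

open RipsComplex

variable {X : Type*} [MetricSpace X] {R S : ℝ≥0} {p : X} {H : ℕ → X → X}

theorem incl_apply (h : R ≤ S) (φ : RipsCompactification H R) (f : combingAlgebra (combing H)) :
    RipsCompactification.incl H h φ f = φ ((isCombedMap_incl H h).pullback f) := rfl

theorem incl_point (h : R ≤ S) (w : RipsComplex X R) :
    RipsCompactification.incl H h (CombingCompactification.point _ w) =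
      CombingCompactification.point _ (RipsComplex.incl h w) := rfl

theorem incl_map_vertex [DiscreteTopology X] (h : R ≤ S) (φ : CombingCompactification H) :
    RipsCompactification.incl H h ((isCombedMap_vertex H R).map φ) =
      (isCombedMap_vertex H S).map φ := rfl

variable [ProperSpace X] [DiscreteTopology X]

theorem incl_mem_combingCorona (hcomb : IsCombing p H) (h : R ≤ S) {φ : RipsCompactification H R}
    (hφ : φ ∈ combingCorona (combing (R := R) H)) :
    RipsCompactification.incl H h φ ∈ combingCorona (combing (R := S) H) := by
  obtain ⟨ψ, hψ, rfl⟩ := exists_map_vertex_eq hcomb hφ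
  rw [incl_map_vertex]
  exact map_vertex_mem_combingCorona hψ

/-- Corona points come from `X` and stay in the corona; all others are points of the complex, which
stay outside it and are told apart by their barycentric coordinates. -/
theorem incl_injective (hcomb : IsCombing p H) (hcoh : IsCoherent H) (hexp : IsExpanding H)
    (h : R ≤ S) : Function.Injective (RipsCompactification.incl H h) := by
  intro φ ψ hφψ
  by_cases hφ : φ ∈ combingCorona (combing (R := R) H)
  · by_cases hψ : ψ ∈ combingCorona (combing (R := R) H)
    · obtain ⟨φ', -, rfl⟩ := exists_map_vertex_eq hcomb hφ
      obtain ⟨ψ', -, rfl⟩ := exists_map_vertex_eq hcomb hψ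
      rw [incl_map_vertex, incl_map_vertex] at hφψ
      rw [map_vertex_injective hcomb hφψ]
    · obtain ⟨w, rfl⟩ := eq_point_of_notMem_combingCorona hψ
      have := incl_mem_combingCorona hcomb h hφ
      rw [hφψ, incl_point] at this
      exact (point_notMem_combingCorona hcomb hcoh hexp _ this).elim
  · obtain ⟨u, rfl⟩ := eq_point_of_notMem_combingCorona hφ
    by_cases hψ : ψ ∈ combingCorona (combing (R := R) H)
    · have := incl_mem_combingCorona hcomb h hψ
      rw [← hφψ, incl_point] at this
      exact (point_notMem_combingCorona hcomb hcoh hexp _ this).elim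
    · obtain ⟨w, rfl⟩ := eq_point_of_notMem_combingCorona hψ
      congr 1
      refine ext_coord (Finsupp.ext fun x => ?_)
      obtain ⟨b, -, hb⟩ := exists_eq_sum_coord hcomb hcoh hexp S {x}
      have := congrArg (fun χ : RipsCompactification H S => χ b) hφψ
      simp only [incl_point, CombingCompactification.point_apply, hb, Finset.sum_singleton] at this
      exact_mod_cast this

theorem isClosedEmbedding_incl (hcomb : IsCombing p H) (hcoh : IsCoherent H) (hexp : IsExpanding H)
    (h : R ≤ S) : IsClosedEmbedding (RipsCompactification.incl H h) :=
  (RipsCompactification.incl H h).continuous.isClosedEmbedding (incl_injective hcomb hcoh hexp h)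

end RipsCompactification

/-! ### Piecewise affine interpolation of a sequence -/

section

variable {E : Type*} [AddCommMonoid E] [Module ℝ E]

/-- The piecewise affine interpolation of the sequence `f` at time `T`. -/
noncomputable def interpolate (T : ℝ≥0) (f : ℕ → E) : E :=
  (1 - ((T : ℝ) - ⌊T⌋₊)) • f ⌊T⌋₊ + ((T : ℝ) - ⌊T⌋₊) • f (⌊T⌋₊ + 1)

theorem map_interpolate {F : Type*} [AddCommMonoid F] [Module ℝ F] (L : E →ₗ[ℝ] F) (T : ℝ≥0)
    (f : ℕ → E) : L (interpolate T f) = interpolate T fun n => L (f n) := by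
  unfold interpolate
  simp

theorem interpolate_eq_of_eq {T : ℝ≥0} {f : ℕ → E} {b : E} (h1 : f ⌊T⌋₊ = b)
    (h2 : f (⌊T⌋₊ + 1) = b) : interpolate T f = b := by
  unfold interpolate
  rw [h1, h2, ← add_smul, sub_add_cancel, one_smul]

theorem interpolate_zero (f : ℕ → E) : interpolate 0 f = f 0 := by
  unfold interpolate
  simp

theorem floor_le_and_lt (T : ℝ≥0) : 0 ≤ (T : ℝ) - ⌊T⌋₊ ∧ (T : ℝ) - ⌊T⌋₊ < 1 := by
  have h1 : ((⌊T⌋₊ : ℝ≥0) : ℝ) ≤ T := NNReal.coe_le_coe.2 (Nat.floor_le zero_le)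
  have h2 : (T : ℝ) < ((⌊T⌋₊ + 1 : ℝ≥0) : ℝ) := NNReal.coe_lt_coe.2 (Nat.lt_floor_add_one T)
  push_cast at h1 h2
  constructor <;> linarith

/-- Hat functions as coefficients are visibly continuous in `T`, whereas the formula with `⌊T⌋₊`
changes its terms at the integers. -/
theorem interpolate_eq_sum {T : ℝ≥0} {N : ℕ} (h : ⌊T⌋₊ < N) (f : ℕ → E) :
    interpolate T f = ∑ k ∈ Finset.range (N + 1), max 0 (1 - |(T : ℝ) - k|) • f k := by
  obtain ⟨h1, h2⟩ := floor_le_and_lt T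
  have hsub : ({⌊T⌋₊, ⌊T⌋₊ + 1} : Finset ℕ) ⊆ Finset.range (N + 1) := by
    intro k hk
    simp only [Finset.mem_insert, Finset.mem_singleton] at hk
    rw [Finset.mem_range]; omega
  rw [← Finset.sum_subset hsub, Finset.sum_pair (by omega)]
  · unfold interpolate
    rw [abs_of_nonneg h1, max_eq_right (by linarith), abs_of_nonpos (by push_cast; linarith),
      max_eq_right (by push_cast; linarith)]
    push_cast
    congr 2
    ring
  · intro k _ hk
    simp only [Finset.mem_insert, Finset.mem_singleton, not_or] at hk
    rw [max_eq_left, zero_smul]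
    rcases lt_or_gt_of_ne hk.1 with h | h
    · have h3 : (k : ℝ) + 1 ≤ ⌊T⌋₊ := by exact_mod_cast h
      have := le_abs_self ((T : ℝ) - k)
      linarith
    · have h3 : (⌊T⌋₊ : ℝ) + 2 ≤ k := by exact_mod_cast (by omega : ⌊T⌋₊ + 2 ≤ k)
      have := neg_le_abs ((T : ℝ) - k)
      linarith

theorem interpolate_nonneg (T : ℝ≥0) {f : ℕ → ℝ} (hf : ∀ n, 0 ≤ f n) : 0 ≤ interpolate T f := by
  obtain ⟨h1, h2⟩ := floor_le_and_lt T
  exact add_nonneg (mul_nonneg (by linarith) (hf _)) (mul_nonneg h1 (hf _))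

theorem eventually_abs_interpolate_sub_le (T₀ : ℝ≥0) {ε : ℝ} (hε : 0 < ε) :
    ∀ᶠ T in 𝓝 T₀, ⌊T⌋₊ < ⌊T₀⌋₊ + 2 ∧ ∀ f : ℕ → ℝ, (∀ n, |f n| ≤ 1) →
      |interpolate T f - interpolate T₀ f| ≤ ε := by
  set N := ⌊T₀⌋₊ + 2 with hN
  have h0 : T₀ < (N : ℝ≥0) := (Nat.lt_floor_add_one T₀).trans
    (by rw [hN]; exact_mod_cast Nat.lt_succ_self _)
  let D : ℝ≥0 → ℝ := fun T => ∑ k ∈ Finset.range (N + 1),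
    |max 0 (1 - |(T : ℝ) - k|) - max 0 (1 - |(T₀ : ℝ) - k|)|
  have hD : Continuous D := by fun_prop
  have hD0 : D T₀ < ε := by simpa [D] using hε
  filter_upwards [Iio_mem_nhds h0, hD.continuousAt.eventually (Iio_mem_nhds hD0)] with T hT hT'
  have hT1 : ⌊T⌋₊ < N := (Nat.floor_lt zero_le).2 hT
  refine ⟨hT1, fun f hf => ?_⟩
  rw [interpolate_eq_sum hT1, interpolate_eq_sum (N := N) (by omega), ← Finset.sum_sub_distrib]
  refine (Finset.abs_sum_le_sum_abs _ _).trans (le_trans (Finset.sum_le_sum fun k _ => ?_)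
    (le_of_lt hT'))
  rw [← sub_smul, smul_eq_mul, abs_mul]
  exact mul_le_of_le_one_right (abs_nonneg _) (hf k)

end

theorem RipsComplex.exists_mem_support_of_mem_support_affineExt {X : Type*} [MetricSpace X] {R : ℝ≥0}
    {g : X → X →₀ ℝ} {w : RipsComplex X R} {v : X}
    (h : v ∈ (affineExt g w).support) : ∃ x ∈ w.coord.support, v ∈ (g x).support := by
  classical
  obtain ⟨x, hx, hv⟩ := Finset.mem_biUnion.1 (Finsupp.support_sum h)
  exact ⟨x, hx, Finsupp.support_smul hv⟩

theorem exists_mem_support_of_mem_support_interpolate {X : Type*} {T : ℝ≥0} {f : ℕ → X →₀ ℝ}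
    {v : X}
    (h : v ∈ (interpolate T f).support) : ∃ n, ⌊T⌋₊ ≤ n ∧ n ≤ ⌊T⌋₊ + 1 ∧ v ∈ (f n).support := by
  classical
  rcases Finset.mem_union.1 (Finsupp.support_add h) with h | h
  · exact ⟨_, le_rfl, by omega, Finsupp.support_smul h⟩
  · exact ⟨_, by omega, le_rfl, Finsupp.support_smul h⟩

theorem Finsupp.sum_eq_linearCombination_one {X : Type*} (f : X →₀ ℝ) :
    (f.sum fun _ a => a) = Finsupp.linearCombination ℝ (fun _ : X => (1 : ℝ)) f := by
  simp [Finsupp.linearCombination_apply]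

/-! ### The contracting homotopy -/

/-- The scale `S` is so large that the combing, smoothed at scale `C`, moves `P_R(X)` within
`P_S(X)`. -/
structure IsContractionScale {X : Type*} [MetricSpace X] (H : ℕ → X → X) (C : ℝ) (R S : ℝ≥0) :
    Prop where
  le : R ≤ S
  dist_le : ∀ x y m n, dist x y ≤ R → m ≤ n + 1 → n ≤ m + 1 → dist (H m x) (H n y) + 2 * C ≤ S

theorem IsContractionScale.mono {X : Type*} [MetricSpace X] {H : ℕ → X → X} {C : ℝ}
    {R R' S S' : ℝ≥0} (h : IsContractionScale H C R S) (hR : R' ≤ R) (hS : S ≤ S') :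
    IsContractionScale H C R' S' where
  le := hR.trans (h.le.trans hS)
  dist_le x y m n hxy hm hn := (h.dist_le x y m n (hxy.trans (by exact_mod_cast hR)) hm hn).trans
    (by exact_mod_cast hS)

theorem CoarseSpace.IsCombing.exists_isContractionScale {X : Type*} [MetricSpace X] {p : X}
    {H : ℕ → X → X} (h : IsCombing p H) (C : ℝ) (R : ℝ≥0) :
    ∃ n : ℕ, R < n ∧ IsContractionScale H C R n := by
  obtain ⟨s, -, hs⟩ := h.exists_dist_le R 1
  obtain ⟨n, hn⟩ := exists_nat_gt (max (R : ℝ) (s + 2 * C))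
  have h1 : (R : ℝ) < n := (le_max_left _ _).trans_lt hn
  have h2 : s + 2 * C < n := (le_max_right _ _).trans_lt hn
  have h3 : R < (n : ℝ≥0) := by exact_mod_cast h1
  refine ⟨n, h3, h3.le, fun x y k l hxy hk hl => ?_⟩
  have := hs x y k l hxy hk hl
  rw [NNReal.coe_natCast]
  linarith

namespace IsSmoothing

open RipsComplex

variable {X : Type*} [MetricSpace X] {p : X} {H : ℕ → X → X} {C : ℝ} {B : ℕ → Finset X}
  {G : ℕ → X → X →₀ ℝ} {R S : ℝ≥0}

theorem le_one (hG : IsSmoothing p H C B G) (n : ℕ) (x z : X) : G n x z ≤ 1 := by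
  rw [← hG.sum_eq_one n x]
  by_cases hz : z ∈ (G n x).support
  · exact Finset.single_le_sum (f := G n x) (fun y _ => hG.nonneg n x y) hz
  · rw [Finsupp.notMem_support_iff.1 hz]
    exact Finset.sum_nonneg fun y _ => hG.nonneg n x y

/-- The smoothed combing of `P_R(X)` at time `T`. -/
noncomputable def slide (hG : IsSmoothing p H C B G) (hS : IsContractionScale H C R S) (T : ℝ≥0)
    (w : RipsComplex X R) : RipsComplex X S where
  coord := affineExt (fun x => interpolate T fun n => G n x) w
  nonneg z := by
    change 0 ≤ Finsupp.lapply (R := ℝ) z (affineExt (fun x => interpolate T fun n => G n x) w)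
    rw [map_affineExt]
    simp_rw [map_interpolate]
    exact Finset.sum_nonneg fun x _ => mul_nonneg (w.nonneg x)
      (interpolate_nonneg T fun n => hG.nonneg n x z)
  sum_eq_one := by
    rw [Finsupp.sum_eq_linearCombination_one, map_affineExt]
    refine affineExt_eq_of_forall fun x _ => ?_
    rw [map_interpolate]
    refine interpolate_eq_of_eq ?_ ?_ <;> rw [← Finsupp.sum_eq_linearCombination_one] <;>
      exact hG.sum_eq_one _ _
  -- Each of `u`, `v` is within `C` of a combed vertex of `w`, at times differing by at most `1`;
  -- this is the origin of `2 * C` in `IsContractionScale`.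
  dist_le u hu v hv := by
    obtain ⟨x, hx, hu⟩ := exists_mem_support_of_mem_support_affineExt hu
    obtain ⟨y, hy, hv⟩ := exists_mem_support_of_mem_support_affineExt hv
    obtain ⟨m, hm, hm', hu⟩ := exists_mem_support_of_mem_support_interpolate hu
    obtain ⟨n, hn, hn', hv⟩ := exists_mem_support_of_mem_support_interpolate hv
    have h1 := hG.dist_le m x u hu
    have h2 := hG.dist_le n y v hv
    have h3 := hS.dist_le x y m n (w.dist_le x hx y hy) (by omega) (by omega)
    have h4 := dist_triangle4_right u v (H m x) (H n y)
    linarith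

theorem slide_coord (hG : IsSmoothing p H C B G) (hS : IsContractionScale H C R S) (T : ℝ≥0)
    (w : RipsComplex X R) (z : X) :
    (hG.slide hS T w).coord z = affineExt (fun x => interpolate T fun n => G n x z) w := by
  change Finsupp.lapply (R := ℝ) z (affineExt (fun x => interpolate T fun n => G n x) w) = _
  rw [map_affineExt]
  simp_rw [map_interpolate]
  rfl

theorem support_slide_subset (hG : IsSmoothing p H C B G) (hS : IsContractionScale H C R S)
    {T : ℝ≥0} (w : RipsComplex X R) {B' : Finset X}
    (hB' : ∀ n, ⌊T⌋₊ ≤ n → n ≤ ⌊T⌋₊ + 1 → B n ⊆ B') : (hG.slide hS T w).coord.support ⊆ B' := by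
  intro v hv
  obtain ⟨x, hx, hv⟩ := exists_mem_support_of_mem_support_affineExt hv
  obtain ⟨m, hm, hm', hv⟩ := exists_mem_support_of_mem_support_interpolate hv
  exact hB' m hm hm' (hG.support_subset m x hv)

theorem dist_le_of_mem_support_slide (hG : IsSmoothing p H C B G) (hC : 0 ≤ C)
    (hS : IsContractionScale H C R S) {T : ℝ≥0} {w : RipsComplex X R} {v : X}
    (hv : v ∈ (hG.slide hS T w).coord.support) : dist v (H ⌊T⌋₊ w.carrier) ≤ S := by
  obtain ⟨x, hx, hv⟩ := exists_mem_support_of_mem_support_affineExt hv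
  obtain ⟨m, hm, hm', hv⟩ := exists_mem_support_of_mem_support_interpolate hv
  have h1 := hG.dist_le m x v hv
  have h2 := hS.dist_le x w.carrier m ⌊T⌋₊ (w.dist_le x hx _ w.carrier_mem) (by omega) (by omega)
  have h3 := dist_triangle v (H m x) (H ⌊T⌋₊ w.carrier)
  linarith

theorem slide_eq_incl (hG : IsSmoothing p H C B G) (hS : IsContractionScale H C R S) {T : ℝ≥0}
    {w : RipsComplex X R} (h : ∀ x ∈ w.coord.support, ∀ n, ⌊T⌋₊ ≤ n → G n x = Finsupp.single x 1) :
    hG.slide hS T w = RipsComplex.incl hS.le w := by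
  refine ext_coord (Finsupp.ext fun z => ?_)
  rw [slide_coord]
  classical
  have e : w.coord z = w.coord.sum fun x a => a • (Finsupp.single x (1 : ℝ)) z := by
    have := DFunLike.congr_fun (Finsupp.sum_single w.coord) z
    rw [Finsupp.sum_apply] at this
    rw [← this]
    refine Finset.sum_congr rfl fun x _ => ?_
    simp [Finsupp.single_apply]
  change _ = w.coord z
  rw [e]
  refine Finset.sum_congr rfl fun x hx => ?_
  simp only
  congr 1
  refine interpolate_eq_of_eq ?_ ?_
  · rw [h x hx _ le_rfl]
  · rw [h x hx _ (by omega)]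

theorem slide_zero (hG : IsSmoothing p H C B G) (hS : IsContractionScale H C R S)
    (w : RipsComplex X R) : hG.slide hS 0 w = vertex S p := by
  refine ext_coord ?_
  refine affineExt_eq_of_forall fun x _ => ?_
  rw [interpolate_zero, hG.zero]
  rfl

theorem continuous_slide [ProperSpace X] [DiscreteTopology X] (hG : IsSmoothing p H C B G)
    (hS : IsContractionScale H C R S) (T : ℝ≥0) : Continuous (hG.slide hS T) := by
  refine continuous_induced_rng.2 (continuous_pi fun z => ?_)
  have := continuous_affineExt (R := R) fun x => interpolate T fun n => G n x z
  convert this using 2 with w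
  exact hG.slide_coord hS T w z

/-- The weight of the point `z` at time `n`, as an element of the combing algebra. -/
noncomputable def weight [DiscreteTopology X] (hG : IsSmoothing p H C B G) (n : ℕ) (z : X) :
    combingAlgebra H :=
  ⟨BoundedContinuousFunction.ofNormedAddCommGroup (fun x => ((G n x z : ℝ) : ℂ))
    continuous_of_discreteTopology 1 fun x => by
      rw [Complex.norm_real, Real.norm_of_nonneg (hG.nonneg n x z)]
      exact hG.le_one n x z,
    hG.vanishingVariation n z, hG.tendstoUniformly n z⟩

theorem exists_mem_combingAlgebra_slide_coord [ProperSpace X] [DiscreteTopology X]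
    (hcomb : IsCombing p H) (hG : IsSmoothing p H C B G) (hS : IsContractionScale H C R S)
    (T : ℝ≥0) (z : X) : ∃ g : combingAlgebra (combing (R := R) H),
      ∀ w, (g : RipsComplex X R →ᵇ ℂ) w = (((hG.slide hS T w).coord z : ℝ) : ℂ) := by
  refine ⟨extend hcomb R (((1 - ((T : ℝ) - ⌊T⌋₊) : ℝ) : ℂ) • hG.weight ⌊T⌋₊ z +
    (((T : ℝ) - ⌊T⌋₊ : ℝ) : ℂ) • hG.weight (⌊T⌋₊ + 1) z), fun w => ?_⟩
  rw [slide_coord, RipsComplex.extend_apply]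
  have := map_affineExt (Complex.ofRealCLM : ℝ →ₗ[ℝ] ℂ)
    (fun x => interpolate T fun n => G n x z) w
  refine Eq.trans ?_ this.symm
  congr 1
  funext x
  rw [map_interpolate]
  rfl

end IsSmoothing

theorem CoarseSpace.isBounded_biUnion {Y ι : Type*} [CoarseSpace Y] (s : Finset ι) {K : ι → Set Y}
    (hK : ∀ i, CoarseSpace.IsBounded (K i)) : CoarseSpace.IsBounded (⋃ i ∈ s, K i) := by
  classical
  induction s using Finset.induction_on with
  | empty => exact CoarseSpace.subset CoarseSpace.diag (by simp)
  | insert a s _ ih =>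
    rw [Finset.set_biUnion_insert]
    exact CoarseSpace.isBounded_union (hK a) ih

namespace RipsComplex

variable {X Y : Type*} [MetricSpace X] {S : ℝ≥0} {F : Y → RipsComplex X S} {B : Finset X}

/-- On a finite subcomplex `f` is uniformly continuous in the coordinates, so mere continuity of `f`
suffices, and the coordinates of `F` carry the vanishing variation. -/
theorem vanishingVariation_comp [CoarseSpace Y] (hF : ∀ y, (F y).coord.support ⊆ B)
    (hv : ∀ z, VanishingVariation fun y => (((F y).coord z : ℝ) : ℂ)) {f : RipsComplex X S → ℂ}
    (hf : Continuous f) : VanishingVariation fun y => f (F y) := by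
  intro E hE ε hε
  obtain ⟨δ, hδ, h⟩ := exists_forall_norm_sub_lt hf B hε
  choose K hK hK' using fun z => hv z E hE δ hδ
  refine ⟨⋃ z ∈ B, K z, isBounded_biUnion B hK, fun x y hxy hx => h _ _ (hF x) (hF y) ?_⟩
  intro z hz
  have := hK' z x y hxy fun hxz => hx (mem_biUnion (s := (B : Set X)) hz hxz)
  rwa [← Complex.ofReal_sub, Complex.norm_real] at this

theorem tendstoUniformly_comp {H : ℕ → Y → Y} (hF : ∀ y, (F y).coord.support ⊆ B)
    (ht : ∀ z, TendstoUniformly (fun n y => (((F (H n y)).coord z : ℝ) : ℂ))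
      (fun y => (((F y).coord z : ℝ) : ℂ)) atTop) {f : RipsComplex X S → ℂ} (hf : Continuous f) :
    TendstoUniformly (fun n y => f (F (H n y))) (fun y => f (F y)) atTop := by
  simp_rw [Metric.tendstoUniformly_iff] at ht ⊢
  intro ε hε
  obtain ⟨δ, hδ, h⟩ := exists_forall_norm_sub_lt hf B hε
  filter_upwards [(Finset.eventually_all B).2 fun z _ => ht z δ hδ] with n hn y
  rw [dist_eq_norm]
  refine h _ _ (hF _) (hF _) fun z hz => ?_
  have := hn z hz y
  rwa [dist_eq_norm, ← Complex.ofReal_sub, Complex.norm_real] at this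

end RipsComplex

/-- The reparametrization of `(0, 1]` by `[0, ∞)` that reverses the direction. -/
noncomputable def homotopyTime (t : I) : ℝ≥0 := Real.toNNReal ((t : ℝ)⁻¹ - 1)

theorem homotopyTime_one : homotopyTime 1 = 0 := by
  simp [homotopyTime]

theorem continuousAt_homotopyTime {t : I} (ht : t ≠ 0) : ContinuousAt homotopyTime t := by
  have h : (t : ℝ) ≠ 0 := fun h => ht (Subtype.ext h)
  exact continuous_real_toNNReal.continuousAt.comp
    ((continuous_subtype_val.continuousAt.inv₀ h).sub continuousAt_const)

/-- At `t = 0`, where the time should be infinite, `homotopyTime` has the default value `0`; hence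
the exclusion. -/
theorem eventually_le_homotopyTime (M : ℝ≥0) : ∀ᶠ t in 𝓝 (0 : I), t ≠ 0 → M ≤ homotopyTime t := by
  have h1 : ((0 : I) : ℝ) < (M + 1 : ℝ)⁻¹ := by
    have : (0 : ℝ) < M + 1 := by positivity
    simpa using this
  filter_upwards [continuous_subtype_val.continuousAt.eventually (Iio_mem_nhds h1)] with t ht ht0
  have h2 : (0 : ℝ) < t := lt_of_le_of_ne t.2.1 fun h => ht0 (Subtype.ext h.symm)
  rw [homotopyTime, ← NNReal.coe_le_coe]
  refine le_trans ?_ (Real.le_coe_toNNReal _)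
  have h3 : (M + 1 : ℝ) < (t : ℝ)⁻¹ := (lt_inv_comm₀ h2 (by positivity)).1 ht
  linarith

namespace IsSmoothing

open RipsComplex

variable {X : Type*} [MetricSpace X] {p : X} {H : ℕ → X → X} {C : ℝ} {B : ℕ → Finset X}
  {G : ℕ → X → X →₀ ℝ} {R S : ℝ≥0}

/-- The smoothed combing, as a homotopy from the inclusion `P_R(X) ⊆ P_S(X)` to a constant map. -/
noncomputable def homotopy (hG : IsSmoothing p H C B G) (hS : IsContractionScale H C R S) (t : I)
    (w : RipsComplex X R) : RipsComplex X S :=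
  if t = 0 then RipsComplex.incl hS.le w else hG.slide hS (homotopyTime t) w

theorem homotopy_zero (hG : IsSmoothing p H C B G) (hS : IsContractionScale H C R S) :
    hG.homotopy hS 0 = RipsComplex.incl hS.le :=
  funext fun _ => if_pos rfl

theorem homotopy_of_ne_zero (hG : IsSmoothing p H C B G) (hS : IsContractionScale H C R S) {t : I}
    (ht : t ≠ 0) : hG.homotopy hS t = hG.slide hS (homotopyTime t) :=
  funext fun _ => if_neg ht

theorem homotopy_one (hG : IsSmoothing p H C B G) (hS : IsContractionScale H C R S)
    (w : RipsComplex X R) : hG.homotopy hS 1 w = vertex S p := by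
  rw [homotopy_of_ne_zero hG hS one_ne_zero, homotopyTime_one, slide_zero]

theorem support_slide_subset_union [DecidableEq X] (hG : IsSmoothing p H C B G)
    (hS : IsContractionScale H C R S) (T : ℝ≥0) (w : RipsComplex X R) :
    (hG.slide hS T w).coord.support ⊆ B ⌊T⌋₊ ∪ B (⌊T⌋₊ + 1) := by
  refine hG.support_slide_subset hS w fun n h1 h2 => ?_
  obtain rfl | rfl : n = ⌊T⌋₊ ∨ n = ⌊T⌋₊ + 1 := by omega
  · exact Finset.subset_union_left
  · exact Finset.subset_union_right

/-- This gives continuity of the homotopy at `t = 0`. Near `p` the slide has become the inclusion.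
Far out, `f` is compared along `slide w`, the vertex `H ⌊T⌋₊ w.carrier`, the vertex `w.carrier` and
`w`: the outer steps use vanishing variation, the middle one convergence under the combing. -/
theorem exists_forall_norm_slide_sub_le (hcomb : IsCombing p H) (hcoh : IsCoherent H)
    (hC : 0 ≤ C) (hG : IsSmoothing p H C B G) (hS : IsContractionScale H C R S)
    {f : RipsComplex X S →ᵇ ℂ} (hf : f ∈ combingAlgebra (combing (R := S) H)) {ε : ℝ}
    (hε : 0 < ε) : ∃ M : ℝ≥0, ∀ T ≥ M, ∀ w : RipsComplex X R,
      ‖f (hG.slide hS T w) - f (RipsComplex.incl hS.le w)‖ ≤ ε := by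
  obtain ⟨c, hc0, hc⟩ := hcoh.exists_dist_le
  obtain ⟨ρ, hρ⟩ := (vanishingVariation_iff p).1 hf.1 S (ε / 3) (by positivity)
  obtain ⟨N₀, hN₀⟩ := hcomb.exists_dist_le_of_dist_le hc (S + ρ)
  obtain ⟨N₁, hN₁⟩ := eventually_atTop.1 (Metric.tendstoUniformly_iff.1 hf.2 (ε / 3) (by positivity))
  -- The extra `R` covers all vertices of a simplex whose carrier vertex is within `S + ρ + c` of
  -- `p`.
  obtain ⟨N₂, hN₂⟩ := hG.eventually_single (R + (S + ρ + c))
  refine ⟨(max N₀ (max N₁ N₂) : ℕ), fun T hT w => ?_⟩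
  have hn : max N₀ (max N₁ N₂) ≤ ⌊T⌋₊ := Nat.le_floor hT
  simp only [max_le_iff] at hn
  obtain ⟨hn0, hn1, hn2⟩ := hn
  by_cases hw : dist w.carrier p ≤ S + ρ + c
  · rw [hG.slide_eq_incl hS, sub_self, norm_zero]
    · exact hε.le
    · intro x hx n hn
      refine hN₂ n (hn2.trans hn) x ((dist_triangle x w.carrier p).trans (add_le_add ?_ hw))
      exact w.dist_le x hx _ w.carrier_mem
  · set u := hG.slide hS T w with hu
    have hn3 : S + ρ < dist (H ⌊T⌋₊ w.carrier) p := by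
      by_contra! hcon
      exact hw (hN₀ _ hn0 _ hcon)
    have hS0 : (0 : ℝ) ≤ S := S.2
    have h1 := hρ u (vertex S (H ⌊T⌋₊ w.carrier)) (fun v hv v' hv' => by
      rw [support_vertex, Finset.mem_singleton] at hv'
      rw [hv']
      exact hG.dist_le_of_mem_support_slide hC hS hv) (by
        have h3 := hG.dist_le_of_mem_support_slide hC hS u.carrier_mem
        have h4 := dist_triangle_left (H ⌊T⌋₊ w.carrier) p u.carrier
        linarith)
    have h2 := hN₁ _ hn1 (vertex S w.carrier)
    rw [combing_vertex, dist_comm, dist_eq_norm] at h2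
    have h3 := hρ (RipsComplex.incl hS.le w) (vertex S w.carrier) (fun v hv v' hv' => by
      rw [support_vertex, Finset.mem_singleton] at hv'
      rw [hv']
      exact (RipsComplex.incl hS.le w).dist_le v hv _ w.carrier_mem) (by
        change ρ < dist w.carrier p
        linarith)
    rw [norm_sub_rev] at h3
    have e : f u - f (RipsComplex.incl hS.le w) = (f u - f (vertex S (H ⌊T⌋₊ w.carrier))) +
      (f (vertex S (H ⌊T⌋₊ w.carrier)) - f (vertex S w.carrier)) +
      (f (vertex S w.carrier) - f (RipsComplex.incl hS.le w)) := by ring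
    rw [e]
    exact (norm_add₃_le).trans (by linarith)

theorem eventually_norm_slide_sub_lt (hG : IsSmoothing p H C B G)
    (hS : IsContractionScale H C R S) {f : RipsComplex X S → ℂ} (hf : Continuous f) (T₀ : ℝ≥0)
    {ε : ℝ} (hε : 0 < ε) : ∀ᶠ T in 𝓝 T₀, ∀ w : RipsComplex X R,
      ‖f (hG.slide hS T w) - f (hG.slide hS T₀ w)‖ < ε := by
  classical
  -- For `T` near `T₀`, interpolation involves indices up to `⌊T₀⌋₊ + 2` only, so one finite
  -- subcomplex contains all the slides.
  obtain ⟨δ, hδ, h⟩ := exists_forall_norm_sub_lt hf ((Finset.range (⌊T₀⌋₊ + 3)).biUnion B) hε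
  have hB : ∀ T : ℝ≥0, ⌊T⌋₊ < ⌊T₀⌋₊ + 2 → ∀ n, ⌊T⌋₊ ≤ n → n ≤ ⌊T⌋₊ + 1 →
      B n ⊆ (Finset.range (⌊T₀⌋₊ + 3)).biUnion B := fun T hT n _ hn =>
    Finset.subset_biUnion_of_mem B (Finset.mem_range.2 (by omega))
  filter_upwards [eventually_abs_interpolate_sub_le T₀ (half_pos hδ)] with T hT w
  refine h _ _ (hG.support_slide_subset hS w (hB T hT.1))
    (hG.support_slide_subset hS w (hB T₀ (by omega))) fun z _ => ?_
  rw [slide_coord, slide_coord, ← Real.norm_eq_abs]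
  refine lt_of_le_of_lt (norm_affineExt_sub_affineExt_le fun x => ?_) (half_lt_self hδ)
  exact hT.2 _ fun n => abs_le.2 ⟨by linarith [hG.nonneg n x z], hG.le_one n x z⟩

variable [ProperSpace X] [DiscreteTopology X]

theorem isCombedHomotopy (hcomb : IsCombing p H) (hcoh : IsCoherent H) (hC : 0 ≤ C)
    (hG : IsSmoothing p H C B G) (hS : IsContractionScale H C R S) :
    IsCombedHomotopy (combing (R := R) H) (combing (R := S) H) (hG.homotopy hS) where
  continuous t := by
    rcases eq_or_ne t 0 with rfl | ht
    · rw [homotopy_zero]; exact (isCombedMap_incl H hS.le).continuous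
    · rw [homotopy_of_ne_zero hG hS ht]; exact hG.continuous_slide hS _
  vanishingVariation t f hf := by
    classical
    rcases eq_or_ne t 0 with rfl | ht
    · rw [homotopy_zero]; exact ((isCombedMap_incl H hS.le).pullback ⟨f, hf⟩).2.1
    · rw [homotopy_of_ne_zero hG hS ht]
      refine vanishingVariation_comp (hG.support_slide_subset_union hS _) (fun z => ?_) f.continuous
      obtain ⟨g, hg⟩ := exists_mem_combingAlgebra_slide_coord hcomb hG hS (homotopyTime t) z
      simp_rw [← hg]
      exact g.2.1
  tendstoUniformly t f hf := by
    classical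
    rcases eq_or_ne t 0 with rfl | ht
    · rw [homotopy_zero]; exact ((isCombedMap_incl H hS.le).pullback ⟨f, hf⟩).2.2
    · rw [homotopy_of_ne_zero hG hS ht]
      refine tendstoUniformly_comp (hG.support_slide_subset_union hS _) (fun z => ?_) f.continuous
      obtain ⟨g, hg⟩ := exists_mem_combingAlgebra_slide_coord hcomb hG hS (homotopyTime t) z
      simp_rw [← hg]
      exact g.2.2
  eventually_le f hf t₀ ε hε := by
    rcases eq_or_ne t₀ 0 with rfl | ht₀
    · obtain ⟨M, hM⟩ := exists_forall_norm_slide_sub_le hcomb hcoh hC hG hS hf hε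
      filter_upwards [eventually_le_homotopyTime M] with t ht w
      rcases eq_or_ne t 0 with rfl | ht0
      · rw [sub_self, norm_zero]; exact hε.le
      · rw [homotopy_zero, homotopy_of_ne_zero hG hS ht0]
        exact hM _ (ht ht0) w
    · filter_upwards [(continuousAt_homotopyTime ht₀).eventually
        (hG.eventually_norm_slide_sub_lt hS f.continuous _ hε), isOpen_ne.mem_nhds ht₀] with t ht ht0 w
      rw [homotopy_of_ne_zero hG hS ht₀, homotopy_of_ne_zero hG hS ht0]
      exact (ht w).le

end IsSmoothing

-- The induced homotopies of compactifications and their compatibility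

namespace IsSmoothing

open RipsComplex

variable {X : Type*} [MetricSpace X] [ProperSpace X] [DiscreteTopology X] {p : X} {H : ℕ → X → X}
  {C : ℝ} {B : ℕ → Finset X} {G : ℕ → X → X →₀ ℝ} {R R' S S' : ℝ≥0}

theorem map_zero (hcomb : IsCombing p H) (hcoh : IsCoherent H) (hC : 0 ≤ C)
    (hG : IsSmoothing p H C B G) (hS : IsContractionScale H C R S) (φ : RipsCompactification H R) :
    (isCombedHomotopy hcomb hcoh hC hG hS).map (0, φ) = RipsCompactification.incl H hS.le φ := by
  refine WeakDual.CharacterSpace.ext fun f => ?_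
  rw [IsCombedHomotopy.map_apply, RipsCompactification.incl_apply]
  congr 1
  ext w
  rw [IsCombedHomotopy.pullback_apply, homotopy_zero]
  rfl

theorem map_one (hcomb : IsCombing p H) (hcoh : IsCoherent H) (hC : 0 ≤ C)
    (hG : IsSmoothing p H C B G) (hS : IsContractionScale H C R S) (φ : RipsCompactification H R) :
    (isCombedHomotopy hcomb hcoh hC hG hS).map (1, φ) =
      CombingCompactification.point _ (vertex S p) := by
  refine WeakDual.CharacterSpace.ext fun f => ?_
  rw [IsCombedHomotopy.map_apply, CombingCompactification.point_apply]
  have e : (isCombedHomotopy hcomb hcoh hC hG hS).pullback 1 f =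
      algebraMap ℂ _ ((f : RipsComplex X S →ᵇ ℂ) (vertex S p)) := by
    ext w
    rw [IsCombedHomotopy.pullback_apply, homotopy_one]
    rfl
  rw [e, AlgHomClass.commutes]
  rfl

/-- The coordinates of the slide do not involve the target scale. Together with `map_incl` for the
source scale, this is what permits gluing. -/
theorem incl_map (hcomb : IsCombing p H) (hcoh : IsCoherent H) (hC : 0 ≤ C)
    (hG : IsSmoothing p H C B G) (hS : IsContractionScale H C R S)
    (hS' : IsContractionScale H C R S') (h : S ≤ S') (t : I) (φ : RipsCompactification H R) :
    RipsCompactification.incl H h ((isCombedHomotopy hcomb hcoh hC hG hS).map (t, φ)) =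
      (isCombedHomotopy hcomb hcoh hC hG hS').map (t, φ) := by
  refine WeakDual.CharacterSpace.ext fun f => ?_
  rw [IsCombedHomotopy.map_apply, RipsCompactification.incl_apply, IsCombedHomotopy.map_apply]
  congr 1
  ext w
  rw [IsCombedHomotopy.pullback_apply, IsCombedHomotopy.pullback_apply]
  change (f : RipsComplex X S' →ᵇ ℂ) (RipsComplex.incl h (hG.homotopy hS t w)) = _
  congr 1
  unfold homotopy
  split_ifs <;> rfl

theorem map_incl (hcomb : IsCombing p H) (hcoh : IsCoherent H) (hC : 0 ≤ C)
    (hG : IsSmoothing p H C B G) (hS : IsContractionScale H C R S)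
    (hS' : IsContractionScale H C R' S) (h : R ≤ R') (t : I) (φ : RipsCompactification H R) :
    (isCombedHomotopy hcomb hcoh hC hG hS').map (t, RipsCompactification.incl H h φ) =
      (isCombedHomotopy hcomb hcoh hC hG hS).map (t, φ) := by
  refine WeakDual.CharacterSpace.ext fun f => ?_
  rw [IsCombedHomotopy.map_apply, RipsCompactification.incl_apply, IsCombedHomotopy.map_apply]
  congr 1

/-- At positive times, the homotopy moves the compactification off the corona. -/
theorem map_notMem_combingCorona (hcomb : IsCombing p H) (hcoh : IsCoherent H)
    (hexp : IsExpanding H) (hC : 0 ≤ C) (hG : IsSmoothing p H C B G)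
    (hS : IsContractionScale H C R S) {t : I} (ht : t ≠ 0) (φ : RipsCompactification H R) :
    (isCombedHomotopy hcomb hcoh hC hG hS).map (t, φ) ∉ combingCorona (combing (R := S) H) := by
  classical
  intro h
  obtain ⟨b, hb, hb'⟩ := exists_eq_sum_coord hcomb hcoh hexp S
    (B ⌊homotopyTime t⌋₊ ∪ B (⌊homotopyTime t⌋₊ + 1))
  have h0 := h b hb
  -- The slide takes all its vertices from the finite set over which `b` sums. A character in the
  -- corona would have to kill `b`, while here `b` is evaluated to `1`.
  have e : (isCombedHomotopy hcomb hcoh hC hG hS).pullback t b = 1 := by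
    ext w
    rw [IsCombedHomotopy.pullback_apply, hb', homotopy_of_ne_zero hG hS ht,
      sum_coord_eq_one (hG.support_slide_subset_union hS _ w)]
    simp
  rw [IsCombedHomotopy.map_apply, e, _root_.map_one] at h0
  exact one_ne_zero h0

theorem nullhomotopic_incl (hcomb : IsCombing p H) (hcoh : IsCoherent H) (hC : 0 ≤ C)
    (hG : IsSmoothing p H C B G) (hS : IsContractionScale H C R S) :
    (RipsCompactification.incl H hS.le).Nullhomotopic :=
  ⟨CombingCompactification.point _ (vertex S p),
    ⟨{ toContinuousMap := (isCombedHomotopy hcomb hcoh hC hG hS).map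
       map_zero_left := map_zero hcomb hcoh hC hG hS
       map_one_left := map_one hcomb hcoh hC hG hS }⟩⟩

end IsSmoothing

/-! ### The union of the compactified Rips complexes -/

namespace FullRipsCompactification

open RipsComplex

variable {X : Type*} [MetricSpace X] {p : X} {H : ℕ → X → X}

theorem continuous_of (n : ℕ) : Continuous (of H n) :=
  continuous_quotient_mk'.comp continuous_sigmaMk

theorem of_incl {m n : ℕ} (h : m ≤ n) (φ : RipsCompactification H (m : ℝ≥0)) :
    of H n (RipsCompactification.incl H (Nat.cast_le.2 h) φ) = of H m φ :=
  Quotient.sound (s := DirectLimit.setoid (RipsCompactification.transition H)) ⟨n, le_rfl, h, rfl⟩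

theorem exists_eq_of (z : FullRipsCompactification H) : ∃ n φ, z = of H n φ :=
  DirectLimit.exists_eq_mk (RipsCompactification.transition H) z

theorem isClosed_iff {s : Set (FullRipsCompactification H)} :
    IsClosed s ↔ ∀ n, IsClosed (of H n ⁻¹' s) := by
  rw [← isQuotientMap_quotient_mk'.isClosed_preimage, isClosed_sigma_iff]
  rfl

/-- Homotopies on the compactifications of the `P_n(X)` glue to a homotopy on the union. -/
theorem exists_homotopy {Y : Type*} [TopologicalSpace Y]
    (Ψ : ∀ n : ℕ, C(I × RipsCompactification H (n : ℝ≥0), Y))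
    (hΨ : ∀ (m n : ℕ) (h : m ≤ n) t φ,
      Ψ m (t, φ) = Ψ n (t, RipsCompactification.incl H (Nat.cast_le.2 h) φ)) :
    ∃ h : C(I × FullRipsCompactification H, Y), ∀ n t φ, h (t, of H n φ) = Ψ n (t, φ) := by
  -- Currying moves the factor `I` to the target, so continuity need only be checked along the
  -- quotient map itself and not along its product with `I`.
  let L : FullRipsCompactification H → C(I, Y) := DirectLimit.lift (RipsCompactification.transition H)
    (fun n φ => ((Ψ n).comp ContinuousMap.prodSwap).curry φ)
    fun m n h φ => ContinuousMap.ext fun t => hΨ m n h t φ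
  have hL : Continuous L := isQuotientMap_quotient_mk'.continuous_iff.2
    (continuous_sigma fun n => ((Ψ n).comp ContinuousMap.prodSwap).curry.continuous)
  exact ⟨⟨fun q => L q.2 q.1, (hL.comp continuous_snd).eval continuous_fst⟩, fun n t φ => rfl⟩

section Corona

variable [DiscreteTopology X]

theorem coronaMap_eq (φ : combingCorona H) (n : ℕ) :
    coronaMap H φ = of H n ((isCombedMap_vertex H (n : ℝ≥0)).map (φ : CombingCompactification H)) :=
  (of_incl (Nat.zero_le n) _).symm

variable [ProperSpace X]

theorem of_injective (hcomb : IsCombing p H) (hcoh : IsCoherent H) (hexp : IsExpanding H) (n : ℕ) :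
    Function.Injective (of H n) :=
  DirectLimit.mk_injective (RipsCompactification.transition H)
    (fun _ _ h => RipsCompactification.incl_injective hcomb hcoh hexp (Nat.cast_le.2 h)) n

theorem of_mem_range_coronaMap_iff (hcomb : IsCombing p H) (hcoh : IsCoherent H)
    (hexp : IsExpanding H) {n : ℕ} {φ : RipsCompactification H (n : ℝ≥0)} :
    of H n φ ∈ range (coronaMap H) ↔ φ ∈ combingCorona (combing (R := (n : ℝ≥0)) H) := by
  constructor
  · rintro ⟨ψ, hψ⟩
    rw [coronaMap_eq ψ n] at hψ
    rw [← of_injective hcomb hcoh hexp n hψ]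
    exact map_vertex_mem_combingCorona ψ.2
  · intro hφ
    obtain ⟨ψ, hψ, rfl⟩ := exists_map_vertex_eq hcomb hφ
    exact ⟨⟨ψ, hψ⟩, coronaMap_eq _ n⟩

/-- Closedness in the final topology is tested at each scale, where the trace of the image of a
closed set is the image of a compact set. -/
theorem isClosedEmbedding_coronaMap (hcomb : IsCombing p H) (hcoh : IsCoherent H)
    (hexp : IsExpanding H) : IsClosedEmbedding (coronaMap H) := by
  have hcont : ∀ n : ℕ, Continuous fun φ : combingCorona H =>
      (isCombedMap_vertex H (n : ℝ≥0)).map (φ : CombingCompactification H) := fun n =>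
    (ContinuousMap.continuous _).comp continuous_subtype_val
  have : CompactSpace (combingCorona H) :=
    isCompact_iff_compactSpace.1 CombingCompactification.isClosed_combingCorona.isCompact
  refine .of_continuous_injective_isClosedMap ((continuous_of 0).comp (hcont 0))
    (fun φ ψ h => ?_) fun s hs => isClosed_iff.2 fun n => ?_
  · exact Subtype.ext (map_vertex_injective hcomb (of_injective hcomb hcoh hexp 0 h))
  · have e : of H n ⁻¹' (coronaMap H '' s) = (fun φ : combingCorona H =>
        (isCombedMap_vertex H (n : ℝ≥0)).map (φ : CombingCompactification H)) '' s := by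
      ext φ
      refine exists_congr fun ψ => and_congr_right fun _ => ?_
      rw [coronaMap_eq ψ n]
      exact (of_injective hcomb hcoh hexp n).eq_iff
    rw [e]
    exact (hs.isCompact.image (hcont n)).isClosed

theorem range_coronaMap (hcomb : IsCombing p H) (hcoh : IsCoherent H) (hexp : IsExpanding H) :
    range (coronaMap H) = (rips H)ᶜ := by
  ext z
  constructor
  · rintro hz ⟨n, w, rfl⟩
    exact point_notMem_combingCorona hcomb hcoh hexp w
      ((of_mem_range_coronaMap_iff hcomb hcoh hexp).1 hz)
  · intro hz
    obtain ⟨n, φ, rfl⟩ := exists_eq_of z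
    rw [of_mem_range_coronaMap_iff hcomb hcoh hexp]
    by_contra hφ
    obtain ⟨w, rfl⟩ := eq_point_of_notMem_combingCorona hφ
    exact hz ⟨n, w, rfl⟩

/-- The homotopies of the compactified Rips complexes glue to a contraction of the union that
respects the filtration and immediately moves the union off the corona. -/
theorem exists_contraction (hcomb : IsCombing p H) (hcoh : IsCoherent H) (hexp : IsExpanding H) :
    ∃ h : C(I × FullRipsCompactification H, FullRipsCompactification H),
      (∀ z, h (0, z) = z) ∧
      (∀ z, h (1, z) = of H 0 (CombingCompactification.point _ (vertex ((0 : ℕ) : ℝ≥0) p))) ∧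
      (∀ m, ∃ n, ∀ t, ∀ z ∈ step H m, h (t, z) ∈ step H n) ∧
      ∀ t, 0 < t → ∀ z, h (t, z) ∉ range (coronaMap H) := by
  obtain ⟨C, B, G, hC, hG⟩ := exists_isSmoothing hcomb hcoh hexp
  choose N hN hS using fun n : ℕ => hcomb.exists_isContractionScale C (n : ℝ≥0)
  let Φ := fun n => (IsSmoothing.isCombedHomotopy hcomb hcoh hC hG (hS n)).map
  obtain ⟨h, hh⟩ := exists_homotopy
    (fun n => (ContinuousMap.mk _ (continuous_of (H := H) (N n))).comp (Φ n)) (by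
      -- The two maps land at scales `N m` and `N n`; they are compared at the larger one, where
      -- both come from the same slide.
      intro m n hmn t φ
      have h1 : (N m : ℝ≥0) ≤ (max (N m) (N n) : ℕ) := Nat.cast_le.2 (le_max_left _ _)
      have h2 : (N n : ℝ≥0) ≤ (max (N m) (N n) : ℕ) := Nat.cast_le.2 (le_max_right _ _)
      change of H (N m) (Φ m (t, φ)) = of H (N n) (Φ n (t, _))
      rw [← of_incl (le_max_left (N m) (N n)), ← of_incl (le_max_right (N m) (N n))]
      congr 1
      refine (IsSmoothing.incl_map hcomb hcoh hC hG (hS m) ((hS m).mono le_rfl h1) h1 t φ).trans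
        (Eq.symm ?_)
      refine (IsSmoothing.incl_map hcomb hcoh hC hG (hS n) ((hS n).mono le_rfl h2) h2 t _).trans ?_
      exact IsSmoothing.map_incl hcomb hcoh hC hG _ _ (Nat.cast_le.2 hmn) t φ)
  have hh' : ∀ n t φ, h (t, of H n φ) = of H (N n) (Φ n (t, φ)) := hh
  refine ⟨h, fun z => ?_, fun z => ?_, fun m => ⟨N m, ?_⟩, fun t ht z => ?_⟩
  · obtain ⟨n, φ, rfl⟩ := exists_eq_of z
    rw [hh', IsSmoothing.map_zero hcomb hcoh hC, of_incl (Nat.cast_le.1 (hS n).le)]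
  · obtain ⟨n, φ, rfl⟩ := exists_eq_of z
    rw [hh', IsSmoothing.map_one hcomb hcoh hC, ← of_incl (Nat.zero_le (N n)),
      RipsCompactification.incl_point]
    rfl
  · rintro t _ ⟨φ, rfl⟩
    exact ⟨_, (hh' m t φ).symm⟩
  · obtain ⟨n, φ, rfl⟩ := exists_eq_of z
    rw [hh', of_mem_range_coronaMap_iff hcomb hcoh hexp]
    exact IsSmoothing.map_notMem_combingCorona hcomb hcoh hexp hC hG (hS n) ht.ne' φ

end Corona

end FullRipsCompactification

theorem theorem4 {X : Type*} [MetricSpace X] [ProperSpace X] [DiscreteTopology X]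
    (p : X) (H : ℕ → X → X) (hcomb : IsCombing p H) (hcoh : IsCoherent H) (hexp : IsExpanding H) :
    (∀ (R S : ℝ≥0) (h : R ≤ S), IsClosedEmbedding (RipsCompactification.incl H h)) ∧
    (∀ R : ℝ≥0, 0 < R → ∃ (S : ℝ≥0) (h : R < S),
      (RipsCompactification.incl H h.le).Nullhomotopic) ∧
    IsSigmaContractible (FullRipsCompactification.step H) ∧
    IsClosedEmbedding (FullRipsCompactification.coronaMap H) ∧
    range (FullRipsCompactification.coronaMap H) = (FullRipsCompactification.rips H)ᶜ ∧
    IsZSet (range (FullRipsCompactification.coronaMap H)) := by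
  obtain ⟨h, h0, h1, hstep, hpos⟩ :=
    FullRipsCompactification.exists_contraction hcomb hcoh hexp
  have hemb := FullRipsCompactification.isClosedEmbedding_coronaMap hcomb hcoh hexp
  refine ⟨fun R S hRS => RipsCompactification.isClosedEmbedding_incl hcomb hcoh hexp hRS,
    fun R _ => ?_, ⟨_, ⟨h, h0, h1⟩, hstep⟩, hemb,
    FullRipsCompactification.range_coronaMap hcomb hcoh hexp, hemb.isClosed_range, h, h0, hpos⟩
  obtain ⟨C, B, G, hC, hG⟩ := exists_isSmoothing hcomb hcoh hexp
  obtain ⟨n, hn, hS⟩ := hcomb.exists_isContractionScale C R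
  exact ⟨n, hn, IsSmoothing.nullhomotopic_incl hcomb hcoh hC hG hS⟩
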